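/- Let $A=i\,e^{2\pi i/20}$ and $d=-A^2-A^{-2}=\tfrac{1+\sqrt5}{2}$. Let $TLJ(A)$ be the level-3 Temperley–Lieb–Jones category: morphisms are complex linear combinations of planar (Temperley–Lieb) diagrams, a closed loop equals $d$, and the Jones–Wenzl projector $p_4$ is set to $0$; the label $a\in\{0,1,2,3\}$ stands for $a$ parallel strands with $p_a$ inserted. The Fibonacci theory has the two labels $1$ (the label $0$) and $\tau$ (the label $2$). For $i\in\{1,\tau\}$ let $V_{3,\tau^{\otimes 3},i}=\mathrm{Hom}(i,\tau\otimes\tau\otimes\tau)$, with the sesquilinear form $\langle x,y\rangle=\mathrm{Tr}(\bar x y)$ given by the Markov trace, where $\bar x$ is the reflection of $x$ with conjugated coefficients. Let $\rho_{3,\tau^{\otimes 3},i}$ be the coloured Jones representation of the three-strand braid group $B_3$ on this space: each $\tau$-coloured strand is replaced by two parallel strands, and each crossing of single strands is resolved by the Kauffman bracket $\sigma=A\cdot\mathrm{id}+A^{-1}u$, where $u$ is the cap–cup diagram. Then $\langle\cdot,\cdot\rangle$ is an inner product (well defined and positive definite) on $V_{3,\tau^{\otimes 3},i}$, the representation $\rho_{3,\tau^{\otimes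 3},i}$ is unitary, $\dim V_{3,\tau^{\otimes 3},1}=1$ and $\dim V_{3,\tau^{\otimes 3},\tau}=2$, so that $SU(V_{3,\tau^{\otimes 3},\tau})\cong SU(2)$, and for each $i\in\{1,\tau\}$ $$\overline{\rho_{3,\tau^{\otimes 3},i}(B_3)}\supset SU(V_{3,\tau^{\otimes 3},i}).$$ -/

import Mathlib

/-! ### Temperley-Lieb diagrams

A Temperley-Lieb diagram from `m` points (bottom edge) to `n` points (top edge) is, up to isotopy and
removal of closed loops, a pairing of the `m + n` boundary points of a square by non-intersecting
arcs.  The boundary points are numbered `0, ..., m + n - 1` along the boundary: first the `n` top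
points from left to right, then the `m` bottom points from right to left. -/

/-- A noncrossing perfect matching of the `N` boundary points `0, ..., N - 1`: the point `p` is joined
to `partner p` (which is set to `p` for the irrelevant values `N ≤ p`). -/
@[ext]
structure TLDiagram (N : ℕ) where
  partner : ℕ → ℕ
  invol : ∀ p, partner (partner p) = p
  no_fixed : ∀ p, p < N → partner p ≠ p
  outside : ∀ p, N ≤ p → partner p = p
  noncrossing : ∀ p q, p < q → q < partner p → ¬ partner p < partner q

namespace TLDiagram

/-- Renumbering when two new points `j, j + 1` are inserted. -/
def skip (j p : ℕ) : ℕ := if p < j then p else p + 2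

/-- Renumbering when the two points `j, j + 1` are removed. -/
def unskip (j q : ℕ) : ℕ := if q < j then q else q - 2

theorem unskip_skip (j p : ℕ) : unskip j (skip j p) = p := by
  unfold unskip skip; split_ifs <;> omega

theorem skip_unskip {j q : ℕ} (h : q ≠ j) (h' : q ≠ j + 1) : skip j (unskip j q) = q := by
  unfold unskip skip; split_ifs <;> omega

theorem skip_ne (j p : ℕ) : skip j p ≠ j ∧ skip j p ≠ j + 1 := by
  unfold skip; split_ifs <;> omega

theorem skip_lt_skip {j p q : ℕ} : skip j p < skip j q ↔ p < q := by
  unfold skip; split_ifs <;> omega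

theorem skip_inj {j p q : ℕ} : skip j p = skip j q ↔ p = q := by
  unfold skip; split_ifs <;> omega

theorem skip_le {N j p : ℕ} (hj : j ≤ N) : N + 2 ≤ skip j p ↔ N ≤ p := by
  unfold skip; split_ifs <;> omega

/-- Stacking with a cup: insert two new adjacent points `j, j + 1`, joined to each other. -/
def cup {N : ℕ} (j : ℕ) (hj : j ≤ N) (D : TLDiagram N) : TLDiagram (N + 2) where
  partner q := if q = j then j + 1 else if q = j + 1 then j else skip j (D.partner (unskip j q))
  invol q := by
    have h := D.invol (unskip j q)
    have := @skip_unskip j q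
    have := skip_ne j (D.partner (unskip j q))
    have := unskip_skip j (D.partner (unskip j q))
    grind
  no_fixed q hq := by
    have h := D.no_fixed (unskip j q)
    have := @skip_unskip j q
    have := unskip_skip j (D.partner (unskip j q))
    have : q ≠ j → q ≠ j + 1 → unskip j q < N := by unfold unskip; split_ifs <;> omega
    grind
  outside q hq := by
    have h := D.outside (unskip j q)
    have := @skip_unskip j q
    have : N ≤ unskip j q := by unfold unskip; split_ifs <;> omega
    grind
  noncrossing p q hpq h1 h2 := by
    by_cases hp : p = j ∨ p = j + 1
    · grind
    by_cases hq : q = j ∨ q = j + 1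
    · have := skip_ne j (D.partner (unskip j p))
      grind
    have h := D.noncrossing (unskip j p) (unskip j q)
    have e1 := @skip_unskip j p (by tauto) (by tauto)
    have e2 := @skip_unskip j q (by tauto) (by tauto)
    simp only [not_or] at hp hq
    simp only [hp.1, hp.2, hq.1, hq.2, if_false] at h1 h2
    rw [← e1, ← e2] at hpq
    rw [← e2] at h1
    rw [skip_lt_skip] at hpq h1 h2
    exact h hpq h1 h2

/-- The matching `f` after an arc has been glued on between the points `j` and `j + 1`: the points
other than `j, j + 1` that were joined to `j` and to `j + 1` become joined to each other. -/
def join (f : ℕ → ℕ) (j q : ℕ) : ℕ :=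
  if f q = j then f (j + 1) else if f q = j + 1 then f j else f q

theorem join_ne {N : ℕ} (D : TLDiagram (N + 2)) {j q : ℕ} (hj : j ≤ N) (h : q ≠ j ∧ q ≠ j + 1) :
    join D.partner j q ≠ j ∧ join D.partner j q ≠ j + 1 := by
  have h1 := D.invol q
  have h2 := D.invol j
  have h3 := D.invol (j+1)
  have h4 := D.no_fixed j (by omega)
  have h5 := D.no_fixed (j+1) (by omega)
  unfold join
  grind

theorem join_invol {N : ℕ} (D : TLDiagram N) {j q : ℕ} (h : q ≠ j ∧ q ≠ j + 1) :
    join D.partner j (join D.partner j q) = q := by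
  have h1 := D.invol q
  have h2 := D.invol j
  have h3 := D.invol (j+1)
  unfold join
  grind

/-- Stacking with a cap: the points `j, j + 1` are joined by an arc and disappear from the boundary.
A closed loop that is formed when they were already joined to each other is dropped here. -/
def cap {N : ℕ} (j : ℕ) (hj : j ≤ N) (D : TLDiagram (N + 2)) : TLDiagram N where
  partner p := unskip j (join D.partner j (skip j p))
  invol p := by
    have h := join_ne D hj (skip_ne j p)
    rw [skip_unskip h.1 h.2, join_invol D (skip_ne j p), unskip_skip]
  no_fixed p hp := by
    have h := join_ne D hj (skip_ne j p)
    have h1 := skip_ne j p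
    rw [Ne, ← skip_inj (j := j), skip_unskip h.1 h.2]
    have h0 := D.no_fixed (skip j p) (by unfold skip; split_ifs <;> omega)
    have h1 := D.invol (skip j p)
    have h2 := D.invol j
    have h3 := D.invol (j+1)
    unfold join
    grind
  outside p hp := by
    have h := join_ne D hj (skip_ne j p)
    rw [← skip_inj (j := j), skip_unskip h.1 h.2]
    have h0 := D.outside (skip j p) ((skip_le hj).2 hp)
    have := (skip_le hj).2 hp
    unfold join
    grind
  noncrossing p q hpq h1 h2 := by
    have hp := join_ne D hj (skip_ne j p)
    have hq := join_ne D hj (skip_ne j q)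
    rw [← skip_lt_skip (j := j)] at hpq h1 h2
    rw [skip_unskip hp.1 hp.2] at h1 h2
    rw [skip_unskip hq.1 hq.2] at h2
    have ap := skip_ne j p
    have aq := skip_ne j q
    generalize skip j p = x at *
    generalize skip j q = y at *
    unfold join at h1 h2 hp hq
    have i1 := D.invol x
    have i2 := D.invol y
    have i3 := D.invol j
    have i4 := D.invol (j+1)
    have n1 := D.no_fixed j (by omega)
    have n2 := D.no_fixed (j+1) (by omega)
    have nc := D.noncrossing
    split_ifs at h1 h2
    all_goals grind


theorem hook_partner {N : ℕ} {j : ℕ} (hj : j ≤ N) (D : TLDiagram (N + 2)) (q : ℕ) :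
    (cup j hj (cap j hj D)).partner q =
      if q = j then j + 1 else if q = j + 1 then j else join D.partner j q := by
  simp only [cup, cap]
  split_ifs with h1 h2
  · rfl
  · rfl
  · rw [skip_unskip h1 h2]
    have h := join_ne D hj ⟨h1, h2⟩
    exact skip_unskip h.1 h.2

theorem hook_of_eq {N : ℕ} {j : ℕ} (hj : j ≤ N) (D : TLDiagram (N + 2))
    (h : D.partner j = j + 1) : cup j hj (cap j hj D) = D := by
  ext q
  have h1 := D.invol q
  have h2 := D.invol j
  simp only [hook_partner, join]
  grind

theorem hook_up {N : ℕ} {j : ℕ} (hj : j + 1 ≤ N) (D : TLDiagram (N + 2))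
    (h : D.partner j = j + 1) :
    cup j (by omega) (cap j (by omega) (cup (j + 1) hj (cap (j + 1) hj D))) = D := by
  ext q
  have h1 := D.invol q
  have h2 := D.invol j
  have h3 := D.invol (j+2)
  simp only [hook_partner, join]
  grind

theorem hook_down {N : ℕ} {j : ℕ} (hj : j + 1 ≤ N) (D : TLDiagram (N + 2))
    (h : D.partner (j + 1) = j + 2) :
    cup (j + 1) hj (cap (j + 1) hj (cup j (by omega) (cap j (by omega) D))) = D := by
  ext q
  have h1 := D.invol q
  have h2 := D.invol (j+1)
  have h3 := D.invol j
  simp only [hook_partner, join]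
  grind

theorem hook_comm {N : ℕ} {i j : ℕ} (hij : i + 2 ≤ j) (hj : j ≤ N) (D : TLDiagram (N + 2)) :
    cup i (by omega) (cap i (by omega) (cup j hj (cap j hj D))) =
      cup j hj (cap j hj (cup i (by omega) (cap i (by omega) D))) := by
  ext q
  have h1 := D.invol q
  have h2 := D.invol i
  have h3 := D.invol (i+1)
  have h4 := D.invol j
  have h5 := D.invol (j+1)
  have nc := D.noncrossing i (i+1)
  have n1 := D.no_fixed i (by omega)
  have n2 := D.no_fixed (i+1) (by omega)
  have n3 := D.no_fixed j (by omega)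
  have n4 := D.no_fixed (j+1) (by omega)
  have inj : ∀ a b, D.partner a = b → D.partner b = a := fun a b h => by rw [← h, D.invol]
  have e1 : i ≠ j := by omega
  have e2 : i ≠ j + 1 := by omega
  have e3 : i + 1 ≠ j := by omega
  have e4 : i + 1 ≠ j + 1 := by omega
  simp only [hook_partner, join, e1, e2, e3, e4, e1.symm, e2.symm, e3.symm, e4.symm, if_false]
  grind

/-- The number of closed loops in the closed diagram that is formed by gluing `D₁`, reflected, to
`D₂` along all `N` boundary points: the number of connected components of the union of the two
matchings. -/
noncomputable def loops {N : ℕ} (D₁ D₂ : TLDiagram N) : ℕ :=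
  Nat.card (Quot fun p q : Fin N => D₁.partner p = q ∨ D₂.partner p = q)

end TLDiagram

noncomputable section

namespace Fib

open TLDiagram

/-! ### Temperley-Lieb morphisms at the Fibonacci value of the Kauffman variable -/

/-- The Kauffman variable `A = i e^{2πi/20}`. -/
def kauffmanA : ℂ := Complex.I * Complex.exp (2 * Real.pi * Complex.I / 20)

/-- The loop variable `d = -A² - A⁻²`. -/
def loopValue : ℂ := -kauffmanA ^ 2 - kauffmanA⁻¹ ^ 2

theorem kauffmanA_ne_zero : kauffmanA ≠ 0 :=
  mul_ne_zero Complex.I_ne_zero (Complex.exp_ne_zero _)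

/-- Formal linear combinations of Temperley-Lieb diagrams with `N` boundary points.  For
`N = n + m` this is the space of Temperley-Lieb morphisms from `m` points to `n` points. -/
abbrev TLSpace (N : ℕ) : Type := TLDiagram N →₀ ℂ

/-- Stacking with a cup at the points `j, j + 1`. -/
def cupMap {N : ℕ} (j : ℕ) (hj : j ≤ N) : TLSpace N →ₗ[ℂ] TLSpace (N + 2) :=
  Finsupp.lmapDomain ℂ ℂ (cup j hj)

/-- Stacking with a cap at the points `j, j + 1`; a closed loop contributes the factor `d`. -/
def capMap {N : ℕ} (j : ℕ) (hj : j ≤ N) : TLSpace (N + 2) →ₗ[ℂ] TLSpace N :=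
  Finsupp.linearCombination ℂ fun D =>
    Finsupp.single (cap j hj D) (if D.partner j = j + 1 then loopValue else 1)

/-- The action of the Temperley-Lieb generator `u` at the adjacent points `j, j + 1` (a cap followed
by a cup).  It is used only for `j ≤ N`, that is, when both points exist. -/
def tlU {N : ℕ} (j : ℕ) : Module.End ℂ (TLSpace (N + 2)) :=
  if hj : j ≤ N then cupMap j hj ∘ₗ capMap j hj else 0

/-- The sesquilinear extension of `⟨D₁, D₂⟩ = Tr (D̄₁ D₂) = d ^ (number of loops)`. -/
def markovInner {N : ℕ} (x y : TLSpace N) : ℂ :=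
  x.sum fun D₁ a => y.sum fun D₂ b => star a * b * loopValue ^ loops D₁ D₂

/-- The quantum dimensions `Δ₀ = 1`, `Δ₁ = d`, `Δₙ₊₂ = d Δₙ₊₁ - Δₙ`. -/
def delta : ℕ → ℂ
  | 0 => 1
  | 1 => loopValue
  | n + 2 => loopValue * delta (n + 1) - delta n

/-- The Jones-Wenzl projector `p_a` on the `a` adjacent strands `s, ..., s + a - 1`, as a polynomial
in given Temperley-Lieb generators `u_j` (for the strands `j, j + 1`), by Wenzl's recursion
`p_{n+1} = p_n - (Δ_{n-1} / Δ_n) p_n u p_n`. -/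
def jonesWenzl {R : Type*} [Ring R] [Algebra ℂ R] (u : ℕ → R) (s : ℕ) : ℕ → R
  | 0 => 1
  | 1 => 1
  | a + 2 => jonesWenzl u s (a + 1) -
      (delta a / delta (a + 1)) • (jonesWenzl u s (a + 1) * u (s + a) * jonesWenzl u s (a + 1))

/-- The relation `p_{k+1} = 0` at level `k = 3`: the ideal of Temperley-Lieb morphisms generated by
`p_4`.  It consists of the morphisms that are obtained from those in which `p_4` is inserted at four
adjacent boundary points, by stacking with cups and caps and forming linear combinations. -/
inductive IsNull : (N : ℕ) → TLSpace N → Prop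
  | proj {N : ℕ} (s : ℕ) (hs : s + 4 ≤ N + 2) (x : TLSpace (N + 2)) :
      IsNull (N + 2) (jonesWenzl tlU s 4 x)
  | cup {N : ℕ} (j : ℕ) (hj : j ≤ N) {x : TLSpace N} : IsNull N x → IsNull (N + 2) (cupMap j hj x)
  | cap {N : ℕ} (j : ℕ) (hj : j ≤ N) {x : TLSpace (N + 2)} :
      IsNull (N + 2) x → IsNull N (capMap j hj x)
  | zero {N : ℕ} : IsNull N 0
  | add {N : ℕ} {x y : TLSpace N} : IsNull N x → IsNull N y → IsNull N (x + y)
  | smul {N : ℕ} (c : ℂ) {x : TLSpace N} : IsNull N x → IsNull N (c • x)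

/-- The ideal generated by `p_4`, as a subspace. -/
def nullSpace (N : ℕ) : Submodule ℂ (TLSpace N) where
  carrier := {x | IsNull N x}
  add_mem' := IsNull.add
  zero_mem' := IsNull.zero
  smul_mem' c _ := IsNull.smul c

/-- Morphisms of the Temperley-Lieb-Jones category at level 3 between uncoloured points: linear
combinations of Temperley-Lieb diagrams modulo `p_4 = 0`. -/
abbrev TLJSpace (N : ℕ) : Type := TLSpace N ⧸ nullSpace N

theorem tlU_mem {N : ℕ} (j : ℕ) : nullSpace (N + 2) ≤ (nullSpace (N + 2)).comap (tlU j) := by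
  intro x hx
  rw [Submodule.mem_comap]
  unfold tlU
  split_ifs with hj
  · exact IsNull.cup j hj (IsNull.cap j hj hx)
  · exact IsNull.zero

/-- The generator `u_j` acting on the quotient by `p_4 = 0`. -/
def tljU {N : ℕ} (j : ℕ) : Module.End ℂ (TLJSpace (N + 2)) :=
  (nullSpace (N + 2)).mapQ (nullSpace (N + 2)) (tlU j) (tlU_mem j)

/-! ### The Temperley-Lieb relations -/

theorem tlU_single {N j : ℕ} (hj : j ≤ N) (D : TLDiagram (N + 2)) (c : ℂ) :
    tlU j (Finsupp.single D c) = Finsupp.single (cup j hj (cap j hj D))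
      (c * if D.partner j = j + 1 then loopValue else 1) := by
  simp [tlU, hj, cupMap, capMap, Finsupp.mapDomain_single]

theorem tlU_mul_self {N : ℕ} (j : ℕ) :
    (tlU j * tlU j : Module.End ℂ (TLSpace (N + 2))) = loopValue • tlU j := by
  by_cases hj : j ≤ N
  · refine Finsupp.lhom_ext fun D c => ?_
    have h : (cup j hj (cap j hj D)).partner j = j + 1 := by simp [hook_partner]
    simp only [Module.End.mul_apply, LinearMap.smul_apply, tlU_single hj, h, hook_of_eq hj _ h,
      if_true, Finsupp.smul_single, smul_eq_mul]
    congr 1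
    ring
  · simp [tlU, hj]

theorem tlU_up {N j : ℕ} (hj : j + 1 ≤ N) :
    (tlU j * tlU (j + 1) * tlU j : Module.End ℂ (TLSpace (N + 2))) = tlU j := by
  have hj' : j ≤ N := by omega
  refine Finsupp.lhom_ext fun D c => ?_
  have h : (cup j hj' (cap j hj' D)).partner j = j + 1 := by simp [hook_partner]
  have h1 : (cup j hj' (cap j hj' D)).partner (j + 1) = j := by simp [hook_partner]
  have h2 : (cup (j + 1) hj (cap (j + 1) hj (cup j hj' (cap j hj' D)))).partner j ≠ j + 1 := by
    have n1 := D.no_fixed (j + 1) (by omega)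
    have i1 := D.invol (j + 2)
    have i2 := D.invol j
    simp only [hook_partner, join]
    grind
  have h3 : ¬ j = j + 1 + 1 := by omega
  simp only [Module.End.mul_apply, tlU_single hj, tlU_single hj', hook_up hj _ h, h1, h2, h3,
    if_false, mul_one]

theorem tlU_down {N j : ℕ} (hj : j + 1 ≤ N) :
    (tlU (j + 1) * tlU j * tlU (j + 1) : Module.End ℂ (TLSpace (N + 2))) = tlU (j + 1) := by
  have hj' : j ≤ N := by omega
  refine Finsupp.lhom_ext fun D c => ?_
  have h : (cup (j + 1) hj (cap (j + 1) hj D)).partner (j + 1) = j + 2 := by simp [hook_partner]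
  have h0 := (cup (j + 1) hj (cap (j + 1) hj D)).invol (j + 1)
  have h1 : (cup (j + 1) hj (cap (j + 1) hj D)).partner j ≠ j + 1 := by
    have := (cup (j + 1) hj (cap (j + 1) hj D)).invol j
    grind
  have h2 : (cup j hj' (cap j hj' (cup (j + 1) hj (cap (j + 1) hj D)))).partner (j + 1) ≠
      j + 1 + 1 := by
    simp only [hook_partner]
    grind
  simp only [Module.End.mul_apply, tlU_single hj, tlU_single hj', hook_down hj _ h, h1, h2,
    if_false, mul_one]

theorem tlU_comm {N i j : ℕ} (hij : i + 2 ≤ j) :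
    (tlU i * tlU j : Module.End ℂ (TLSpace (N + 2))) = tlU j * tlU i := by
  by_cases hj : j ≤ N
  · have hi : i ≤ N := by omega
    refine Finsupp.lhom_ext fun D c => ?_
    simp only [Module.End.mul_apply, tlU_single hj, tlU_single hi, hook_comm hij hj]
    congr 1
    have h1 := D.invol i
    have h2 := D.invol (i + 1)
    have h3 := D.invol j
    have h4 := D.invol (j + 1)
    have nc := D.noncrossing i (i + 1)
    have e1 : i ≠ j := by omega
    have e2 : i ≠ j + 1 := by omega
    have e3 : (cup j hj (cap j hj D)).partner i = i + 1 ↔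
        D.partner i = i + 1 ∨ D.partner i = j + 1 ∧ D.partner (i + 1) = j := by
      simp only [hook_partner, join]
      grind
    have e4 : (cup i hi (cap i hi D)).partner j = j + 1 ↔
        D.partner j = j + 1 ∨ D.partner i = j + 1 ∧ D.partner (i + 1) = j := by
      simp only [hook_partner, join]
      grind
    simp only [e3, e4]
    grind
  · simp [tlU, hj]

theorem tljU_mul_self {N : ℕ} (j : ℕ) :
    (tljU j * tljU j : Module.End ℂ (TLJSpace (N + 2))) = loopValue • tljU j := by
  refine LinearMap.ext fun q => ?_
  obtain ⟨x, rfl⟩ := Submodule.Quotient.mk_surjective _ q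
  exact congrArg Submodule.Quotient.mk (LinearMap.congr_fun (tlU_mul_self j) x)

theorem tljU_up {N j : ℕ} (hj : j + 1 ≤ N) :
    (tljU j * tljU (j + 1) * tljU j : Module.End ℂ (TLJSpace (N + 2))) = tljU j := by
  refine LinearMap.ext fun q => ?_
  obtain ⟨x, rfl⟩ := Submodule.Quotient.mk_surjective _ q
  exact congrArg Submodule.Quotient.mk (LinearMap.congr_fun (tlU_up hj) x)

theorem tljU_down {N j : ℕ} (hj : j + 1 ≤ N) :
    (tljU (j + 1) * tljU j * tljU (j + 1) : Module.End ℂ (TLJSpace (N + 2))) = tljU (j + 1) := by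
  refine LinearMap.ext fun q => ?_
  obtain ⟨x, rfl⟩ := Submodule.Quotient.mk_surjective _ q
  exact congrArg Submodule.Quotient.mk (LinearMap.congr_fun (tlU_down hj) x)

theorem tljU_comm {N i j : ℕ} (hij : i + 2 ≤ j) :
    (tljU i * tljU j : Module.End ℂ (TLJSpace (N + 2))) = tljU j * tljU i := by
  refine LinearMap.ext fun q => ?_
  obtain ⟨x, rfl⟩ := Submodule.Quotient.mk_surjective _ q
  exact congrArg Submodule.Quotient.mk (LinearMap.congr_fun (tlU_comm hij) x)

/-! ### Crossings -/

/-- The Kauffman bracket `A + A⁻¹ u_j` of the crossing of the strands `j, j + 1`, as an invertible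
operator with inverse `A⁻¹ + A u_j`. -/
def crossing {N : ℕ} (j : ℕ) : (Module.End ℂ (TLJSpace (N + 2)))ˣ where
  val := kauffmanA • 1 + kauffmanA⁻¹ • tljU j
  inv := kauffmanA⁻¹ • 1 + kauffmanA • tljU j
  val_inv := by
    have h := kauffmanA_ne_zero
    simp only [add_mul, mul_add, smul_mul_smul_comm, one_mul, mul_one, tljU_mul_self, loopValue]
    match_scalars <;> field_simp
    ring
  inv_val := by
    have h := kauffmanA_ne_zero
    simp only [add_mul, mul_add, smul_mul_smul_comm, one_mul, mul_one, tljU_mul_self, loopValue]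
    match_scalars <;> field_simp
    ring

theorem crossing_braid {N j : ℕ} (hj : j + 1 ≤ N) :
    (crossing j * crossing (j + 1) * crossing j : (Module.End ℂ (TLJSpace (N + 2)))ˣ) =
      crossing (j + 1) * crossing j * crossing (j + 1) := by
  have h := kauffmanA_ne_zero
  ext1
  simp only [crossing, Units.val_mul, add_mul, mul_add, smul_mul_smul_comm, one_mul, mul_one,
    tljU_mul_self, tljU_up hj, tljU_down hj, smul_smul, loopValue]
  match_scalars <;> field_simp <;> ring

theorem crossing_comm {N i j : ℕ} (hij : i + 2 ≤ j) :
    (crossing i * crossing j : (Module.End ℂ (TLJSpace (N + 2)))ˣ) = crossing j * crossing i := by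
  ext1
  simp only [crossing, Units.val_mul, add_mul, mul_add, smul_mul_smul_comm, one_mul, mul_one,
    tljU_comm hij]
  match_scalars <;> ring

/-- The crossing of the `k`-th and the `(k + 1)`-st pair of strands (`k = 0, 1, ...`): every strand
is doubled, so that one crossing becomes four crossings of single strands. -/
def cabledCrossing {N : ℕ} (k : ℕ) : (Module.End ℂ (TLJSpace (N + 2)))ˣ :=
  crossing (2 * k + 1) * crossing (2 * k) * crossing (2 * k + 2) * crossing (2 * k + 1)

theorem slide {G : Type*} [Group G] {a b c : G} (h1 : a * b * a = b * a * b)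
    (h2 : b * c * b = c * b * c) (h3 : a * c = c * a) :
    b * a * c * b * a = c * (b * a * c * b) ∧ b * a * c * b * c = a * (b * a * c * b) := by
  have h4 : b * c * a * b = b * a * c * b := by rw [mul_assoc b c a, ← h3, ← mul_assoc]
  constructor
  · calc b * a * c * b * a = b * c * (a * b * a) := by rw [← h4]; group
      _ = (b * c * b) * a * b := by rw [h1]; group
      _ = c * (b * c * a * b) := by rw [h2]; group
      _ = c * (b * a * c * b) := by rw [h4]
  · calc b * a * c * b * c = b * a * (c * b * c) := by group
      _ = (b * a * b) * c * b := by rw [← h2]; group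
      _ = a * (b * a * c * b) := by rw [← h1]; group

theorem cable_braid {G : Type*} [Group G] {a b c d e : G} (hab : a * b * a = b * a * b)
    (hbc : b * c * b = c * b * c) (hcd : c * d * c = d * c * d) (hde : d * e * d = e * d * e)
    (hac : a * c = c * a) (had : a * d = d * a) (hae : a * e = e * a) (hbd : b * d = d * b)
    (hbe : b * e = e * b) (hce : c * e = e * c) :
    (b * a * c * b) * (d * c * e * d) * (b * a * c * b) =
      (d * c * e * d) * (b * a * c * b) * (d * c * e * d) := by
  obtain ⟨x1, -⟩ := slide hab hbc hac
  obtain ⟨y1, y2⟩ := slide hcd hde hce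
  obtain ⟨-, x2⟩ := slide hab hbc hac
  have xe : (b * a * c * b) * e = e * (b * a * c * b) := by
    have : Commute (b * a * c * b) e :=
      ((Commute.mul_left (show Commute b e from hbe) hae).mul_left hce).mul_left hbe
    exact this
  have ya : (d * c * e * d) * a = a * (d * c * e * d) := by
    have : Commute (d * c * e * d) a :=
      ((Commute.mul_left (show Commute d a from had.symm) hac.symm).mul_left hae.symm).mul_left
        had.symm
    exact this
  have xyb : (b * a * c * b) * (d * c * e * d) * b = d * ((b * a * c * b) * (d * c * e * d)) := by
    calc (b * a * c * b) * (d * c * e * d) * b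
        = b * a * c * (b * d) * c * e * d * b := by group
      _ = b * a * c * d * b * c * e * (d * b) := by rw [hbd]; group
      _ = b * a * c * d * b * c * (e * b) * d := by rw [← hbd]; group
      _ = b * a * c * d * (b * c * b) * e * d := by rw [← hbe]; group
      _ = b * a * (c * d * c) * b * c * e * d := by rw [hbc]; group
      _ = b * (a * d) * c * d * b * c * e * d := by rw [hcd]; group
      _ = (b * d) * a * c * d * b * c * e * d := by rw [had]; group
      _ = d * b * a * c * (d * b) * c * e * d := by rw [hbd]; group
      _ = d * b * a * c * (b * d) * c * e * d := by rw [← hbd]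
      _ = d * ((b * a * c * b) * (d * c * e * d)) := by group
  generalize hX : b * a * c * b = X at *
  generalize hY : d * c * e * d = Y at *
  calc X * Y * X = (X * Y * b) * a * c * b := by rw [← hX]; group
    _ = d * X * (Y * a) * c * b := by rw [xyb]; group
    _ = d * (X * a) * Y * c * b := by rw [ya]; group
    _ = d * c * X * (Y * c) * b := by rw [x1]; group
    _ = d * c * (X * e) * Y * b := by rw [y1]; group
    _ = d * c * e * (X * Y * b) := by rw [xe]; group
    _ = (d * c * e * d) * X * Y := by rw [xyb]; group
    _ = Y * X * Y := by rw [hY]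

/-! ### The coloured Jones representation -/

/-- The relations of the `n`-strand braid group. -/
def braidRels (n : ℕ) : Set (FreeGroup (Fin (n - 1))) :=
  {r | ∃ i j : Fin (n - 1), (i : ℕ) + 2 ≤ j ∧
      r = .of i * .of j * (.of j * .of i)⁻¹} ∪
  {r | ∃ i j : Fin (n - 1), (i : ℕ) + 1 = j ∧
      r = .of i * .of j * .of i * (.of j * .of i * .of j)⁻¹}

/-- The `n`-strand braid group, with generators `σ_0, ..., σ_{n-2}`. -/
abbrev BraidGroup (n : ℕ) : Type := PresentedGroup (braidRels n)

/-- The cabled crossings satisfy the relations of the three-strand braid group: the action of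
three-strand braids, with every strand doubled, on morphisms to at least six points. -/
def cabledRep (m : ℕ) : BraidGroup 3 →* (Module.End ℂ (TLJSpace (m + 6)))ˣ :=
  PresentedGroup.toGroup (rels := braidRels 3)
    (f := fun k : Fin 2 => (cabledCrossing k : (Module.End ℂ (TLJSpace (m + 4 + 2)))ˣ)) <| by
    rintro r (⟨i, j, hij, rfl⟩ | ⟨i, j, hij, rfl⟩)
    · omega
    · obtain rfl : i = (0 : Fin 2) := Fin.ext (by have := j.isLt; simp; omega)
      obtain rfl : j = (1 : Fin 2) := Fin.ext (by simpa using hij.symm)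
      simp only [map_mul, map_inv, FreeGroup.lift_apply_of]
      rw [mul_inv_eq_one]
      exact cable_braid (crossing_braid (by omega)) (crossing_braid (by omega))
        (crossing_braid (by omega)) (crossing_braid (by omega)) (crossing_comm (by omega))
        (crossing_comm (by omega)) (crossing_comm (by omega)) (crossing_comm (by omega))
        (crossing_comm (by omega)) (crossing_comm (by omega))

/-- The two labels of the Fibonacci theory. -/
inductive Charge
  | one
  | tau

/-- The corresponding labels `0, 2` in `{0, 1, 2, 3}`: the label `a` stands for `a` parallel strands
with the Jones-Wenzl projector `p_a` inserted. -/
def Charge.label : Charge → ℕ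
  | one => 0
  | tau => 2

/-- The Jones-Wenzl projectors at the three points coloured `τ` (boundary points `0, ..., 5`) and at
the point coloured `i` (the boundary points from `6` on). -/
def colour (i : Charge) : Module.End ℂ (TLJSpace (i.label + 6)) :=
  jonesWenzl tljU 0 2 * jonesWenzl tljU 2 2 * jonesWenzl tljU 4 2 * jonesWenzl tljU 6 i.label

/-- `V_{3,τ⊗τ⊗τ,i} = Hom(i, τ ⊗ τ ⊗ τ)` in the Temperley-Lieb-Jones category. -/
def V (i : Charge) : Submodule ℂ (TLJSpace (i.label + 6)) := LinearMap.range (colour i)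

theorem semiconj_tljU {N i j : ℕ} {X : (Module.End ℂ (TLJSpace (N + 2)))ˣ}
    (h : X * crossing i = crossing j * X) :
    SemiconjBy (X : Module.End ℂ (TLJSpace (N + 2))) (tljU i) (tljU j) := by
  have hA := kauffmanA_ne_zero
  have h1 := congrArg (fun Y : (Module.End ℂ (TLJSpace (N + 2)))ˣ =>
    kauffmanA • ((Y : Module.End ℂ (TLJSpace (N + 2))) - kauffmanA • X.val)) h
  unfold SemiconjBy
  simpa [crossing, mul_add, add_mul, smul_smul, hA] using h1

theorem semiconj_jonesWenzl {N i j : ℕ} {X : Module.End ℂ (TLJSpace (N + 2))}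
    (h : SemiconjBy X (tljU i) (tljU j)) :
    SemiconjBy X (jonesWenzl tljU i 2) (jonesWenzl tljU j 2) := by
  simp only [SemiconjBy] at h
  simp [jonesWenzl, SemiconjBy, mul_sub, sub_mul, h]

theorem commute_cabledCrossing (i : Charge) (k : Fin 2) :
    Commute ((cabledCrossing k : (Module.End ℂ (TLJSpace (i.label + 4 + 2)))ˣ) :
      Module.End ℂ (TLJSpace (i.label + 4 + 2))) (colour i) := by
  have far : ∀ m, 2 * (k : ℕ) + 4 ≤ m ∨ m + 2 ≤ 2 * (k : ℕ) →
      SemiconjBy ((cabledCrossing k : (Module.End ℂ (TLJSpace (i.label + 4 + 2)))ˣ) :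
        Module.End ℂ (TLJSpace (i.label + 4 + 2))) (tljU m) (tljU m) := by
    intro m hm
    refine semiconj_tljU ?_
    have c : ∀ n, 2 * (k : ℕ) ≤ n → n ≤ 2 * (k : ℕ) + 2 →
        Commute (crossing n : (Module.End ℂ (TLJSpace (i.label + 4 + 2)))ˣ) (crossing m) := by
      intro n h1 h2
      rcases hm with hm | hm
      · exact crossing_comm (by omega)
      · exact (crossing_comm (by omega)).symm
    exact (((c _ (by omega) (by omega)).mul_left (c _ (by omega) (by omega))).mul_left
      (c _ (by omega) (by omega))).mul_left (c _ (by omega) (by omega))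
  obtain ⟨h1, h2⟩ := slide (G := (Module.End ℂ (TLJSpace (i.label + 4 + 2)))ˣ)
    (a := crossing (2 * k)) (b := crossing (2 * k + 1)) (c := crossing (2 * k + 2))
    (crossing_braid (by omega)) (crossing_braid (by omega)) (crossing_comm (by omega))
  have s1 := semiconj_jonesWenzl (semiconj_tljU (X := cabledCrossing k) h1)
  have s2 := semiconj_jonesWenzl (semiconj_tljU (X := cabledCrossing k) h2)
  have s6 : Commute ((cabledCrossing k : (Module.End ℂ (TLJSpace (i.label + 4 + 2)))ˣ) :
      Module.End ℂ (TLJSpace (i.label + 4 + 2))) (jonesWenzl tljU 6 i.label) := by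
    cases i
    · exact Commute.one_right _
    · exact semiconj_jonesWenzl (far 6 (by omega))
  have comm : ∀ m n, m + 2 ≤ n → Commute
      (jonesWenzl tljU m 2 : Module.End ℂ (TLJSpace (i.label + 4 + 2))) (jonesWenzl tljU n 2) := by
    intro m n hmn
    exact semiconj_jonesWenzl (X := jonesWenzl tljU m 2)
      (semiconj_jonesWenzl (X := tljU n) (tljU_comm hmn).symm).symm
  have hk : k = 0 ∨ k = 1 := by omega
  rcases hk with rfl | rfl
  · have H : SemiconjBy ((cabledCrossing 0 : (Module.End ℂ (TLJSpace (i.label + 4 + 2)))ˣ) :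
        Module.End ℂ (TLJSpace (i.label + 4 + 2))) (colour i)
        (jonesWenzl tljU 2 2 * jonesWenzl tljU 0 2 * jonesWenzl tljU 4 2 *
          jonesWenzl tljU 6 i.label) :=
      ((s1.mul_right s2).mul_right (semiconj_jonesWenzl (far 4 (by simp)))).mul_right s6
    rw [(comm 0 2 le_rfl).symm.eq] at H
    exact H
  · have H : SemiconjBy ((cabledCrossing 1 : (Module.End ℂ (TLJSpace (i.label + 4 + 2)))ˣ) :
        Module.End ℂ (TLJSpace (i.label + 4 + 2))) (colour i)
        (jonesWenzl tljU 0 2 * jonesWenzl tljU 4 2 * jonesWenzl tljU 2 2 *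
          jonesWenzl tljU 6 i.label) :=
      (((semiconj_jonesWenzl (far 0 (by simp))).mul_right s1).mul_right s2).mul_right s6
    rw [mul_assoc (jonesWenzl tljU 0 2), (comm 2 4 le_rfl).symm.eq, ← mul_assoc] at H
    exact H

theorem commute_colour (i : Charge) (β : BraidGroup 3) :
    Commute (cabledRep i.label β : Module.End ℂ (TLJSpace (i.label + 6))) (colour i) := by
  have h : β ∈ Subgroup.closure (Set.range (PresentedGroup.of (rels := braidRels 3))) := by
    rw [PresentedGroup.closure_range_of]
    trivial
  induction h using Subgroup.closure_induction with
  | mem x hx =>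
    obtain ⟨k, rfl⟩ := hx
    rw [cabledRep, PresentedGroup.toGroup.of]
    exact commute_cabledCrossing i k
  | one => simp
  | mul x y _ _ hx hy =>
    rw [map_mul, Units.val_mul]
    exact hx.mul_left hy
  | inv x _ hx =>
    rw [map_inv]
    exact hx.units_inv_left

/-- The coloured Jones representation of the three-strand braid group on `V_{3,τ⊗τ⊗τ,i}`. -/
def rho (i : Charge) : BraidGroup 3 →* Module.End ℂ (V i) where
  toFun β := (cabledRep i.label β : Module.End ℂ (TLJSpace (i.label + 6))).restrict
    (p := V i) (q := V i) (by
      rintro _ ⟨x, rfl⟩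
      exact ⟨_, (LinearMap.congr_fun (commute_colour i β) x).symm⟩)
  map_one' := by
    ext x
    simp
  map_mul' β γ := by
    ext x
    simp

/-- `ip` is the inner product on `V_{3,τ⊗τ⊗τ,i}` given by the Markov trace: the trace form
`Tr (x̄ y)` of Temperley-Lieb morphisms induces it, and it is Hermitian and positive definite.  There
is at most one such `ip`, since every vector is the class of a Temperley-Lieb morphism. -/
structure IsTraceInnerProduct (i : Charge) (ip : V i →ₗ⋆[ℂ] V i →ₗ[ℂ] ℂ) : Prop where
  trace_form : ∀ (x y : TLSpace (i.label + 6)) (hx : (nullSpace _).mkQ x ∈ V i)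
    (hy : (nullSpace _).mkQ y ∈ V i),
    ip ⟨(nullSpace _).mkQ x, hx⟩ ⟨(nullSpace _).mkQ y, hy⟩ = markovInner x y
  hermitian : ∀ v w, star (ip w v) = ip v w
  pos : ∀ v, v ≠ 0 → 0 < (ip v v).re

/-- The special unitary group of a complex vector space with an inner product. -/
def specialUnitary {W : Type*} [AddCommGroup W] [Module ℂ W] (ip : W →ₗ⋆[ℂ] W →ₗ[ℂ] ℂ) :
    Set (Module.End ℂ W) :=
  {g | (∀ v w, ip (g v) (g w) = ip v w) ∧ LinearMap.det g = 1}

/-- The canonical topology of the finite-dimensional space of operators on `V_{3,τ⊗τ⊗τ,i}`. -/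
instance endTopology (i : Charge) : TopologicalSpace (Module.End ℂ (V i)) :=
  moduleTopology ℂ (Module.End ℂ (V i))

/-- The dimensions of the spaces `V_{3,τ⊗τ⊗τ,i}`. -/
def Charge.dim : Charge → ℕ
  | one => 1
  | tau => 2

end Fib

end

/-! The trace form first has to descend to the quotient by `p_4`. Cups and caps are adjoint for it
(`loops_cup`, `form_cup_left`), because gluing on a cup on one side closes the same loops as gluing
on a cap on the other. At this value of `d` the quantum dimensions are `1, d, d, 1, 0`, so `p_4`
annihilates every `u_j` on its four strands and its partial trace is `Δ₄/Δ₃ · p_3 = 0`. Innermost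
arcs reduce every pairing with `p_4` to one of these two facts, and so the ideal of `p_4` lies in
the radical (`form_null`).

The dimensions come from two opposite bounds. A diagram with an arc inside one coloured point is
killed by the colouring. One diagram survives for the label `1` and three for `τ`, and the relation
`p_4 = 0` expresses the third of these by the other two (`E₃_eq`). Conversely the Gram matrices of
the remaining diagrams are positive definite: `(d⁻¹)`, and the matrix with diagonal `d²` and
off-diagonal entries `d`. So these diagrams are independent, the form is an inner product, and the
radical never has to be determined exactly. Unitarity holds because `u_j` is self-adjoint and `Ā =
A⁻¹`, so the adjoint of a crossing is its inverse.

For the label `1` the group `SU(1)` is trivial. For `τ` each generator is triangular in the diagram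
basis, with eigenvalues `A²` and `A`. The braids `σ₀σ₁⁻¹` and `σ₁⁻¹σ₀` then act with determinant `1`
and trace `2 - φ`, and their images do not commute. The Galois conjugate of `2 - φ` exceeds `2`, so
their eigenvalues are not roots of unity (`SU2.pow_ne_one`), and the closure of the powers of one of
them contains a maximal torus. The other one lies outside this torus and has nonzero trace, so it
has no zero entry in an eigenbasis of the first. A torus together with such a matrix generates all
of `SU(2)` (`SU2.full_all`). -/

namespace TLDiagram

/-! ### Closed loops under gluing: cups against caps -/

theorem partner_lt {N : ℕ} (D : TLDiagram N) {p : ℕ} (hp : p < N) : D.partner p < N := by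
  by_contra h
  have h1 := D.outside _ (not_lt.1 h)
  rw [D.invol] at h1
  omega

theorem ext_of_lt {N : ℕ} {D D' : TLDiagram N} (h : ∀ p < N, D.partner p = D'.partner p) :
    D = D' := by
  ext p
  by_cases hp : p < N
  · exact h p hp
  · rw [D.outside p (not_lt.1 hp), D'.outside p (not_lt.1 hp)]

theorem skip_lt {N j p : ℕ} (hj : j ≤ N) (hp : p < N) : skip j p < N + 2 := by
  have := @skip_le N j p hj
  omega

theorem unskip_lt {N j q : ℕ} (hj : j ≤ N) (hq : q < N + 2) (h1 : q ≠ j) (h2 : q ≠ j + 1) :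
    unskip j q < N := by
  unfold unskip; split_ifs <;> omega

/-- Two boundary points are joined by one of the two matchings. -/
def Glued {N : ℕ} (D₁ D₂ : TLDiagram N) (p q : Fin N) : Prop :=
  D₁.partner p = q ∨ D₂.partner p = q

theorem loops_eq_card {N : ℕ} (D₁ D₂ : TLDiagram N) : loops D₁ D₂ = Nat.card (Quot (Glued D₁ D₂)) :=
  rfl

theorem loops_comm {N : ℕ} (D₁ D₂ : TLDiagram N) : loops D₁ D₂ = loops D₂ D₁ := by
  rw [loops_eq_card, loops_eq_card]
  congr 2
  ext p q
  exact or_comm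

section LoopsCup

variable {N j : ℕ} (hj : j ≤ N) (D₁ : TLDiagram N) (D₂ : TLDiagram (N + 2))

/-- Renumbering of components when two points are inserted. -/
def skipQuot : Quot (Glued D₁ (cap j hj D₂)) → Quot (Glued (cup j hj D₁) D₂) :=
  Quot.lift (fun p => Quot.mk _ ⟨skip j p, skip_lt hj p.2⟩) <| by
    rintro p q (h | h)
    · refine Quot.sound (Or.inl ?_)
      have := skip_ne j p
      simp [cup, this.1, this.2, unskip_skip, h]
    · have h0 := join_ne D₂ hj (skip_ne j p)
      have h1 : join D₂.partner j (skip j p) = skip j q := by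
        rw [← skip_unskip h0.1 h0.2]
        exact congrArg _ h
      have hs : Quot.mk (Glued (cup j hj D₁) D₂) ⟨j, by omega⟩ = Quot.mk _ ⟨j + 1, by omega⟩ :=
        Quot.sound (Or.inl (by simp [cup]))
      have e : ∀ x y : Fin (N + 2), D₂.partner x = y →
          Quot.mk (Glued (cup j hj D₁) D₂) x = Quot.mk _ y := fun x y h => Quot.sound (Or.inr h)
      unfold join at h1
      split_ifs at h1 with h2 h3
      · exact ((e _ ⟨j, by omega⟩ h2).trans hs).trans (e ⟨j + 1, by omega⟩ _ h1)
      · exact ((e _ ⟨j + 1, by omega⟩ h3).trans hs.symm).trans (e ⟨j, by omega⟩ _ h1)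
      · exact e _ _ h1

/-- The points `j, j + 1` lie on a component that also meets other points. Deleting them only
shortens this component, so the components on both sides correspond. -/
theorem loops_cup_of_ne (h : D₂.partner j ≠ j + 1) :
    loops (cup j hj D₁) D₂ = loops D₁ (cap j hj D₂) := by
  have i1 := D₂.invol j
  have n1 := D₂.no_fixed j (by omega)
  have n2 := D₂.no_fixed (j + 1) (by omega)
  have i2 := D₂.invol (j + 1)
  have lt1 : unskip j (D₂.partner j) < N := unskip_lt hj (D₂.partner_lt (by omega)) n1 h
  have lt2 : unskip j (D₂.partner (j + 1)) < N :=
    unskip_lt hj (D₂.partner_lt (by omega)) (by grind) n2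
  -- Capping joins the former partners of `j` and `j + 1`, so either of them represents the
  -- component on which the two deleted points lay.
  have key : Quot.mk (Glued D₁ (cap j hj D₂)) ⟨_, lt1⟩ = Quot.mk _ ⟨_, lt2⟩ := by
    refine Quot.sound (Or.inr ?_)
    simp only [cap]
    rw [skip_unskip n1 h]
    simp [join, i1]
  let f : Fin (N + 2) → Quot (Glued D₁ (cap j hj D₂)) := fun q =>
    if hq : (q : ℕ) = j ∨ (q : ℕ) = j + 1 then Quot.mk _ ⟨_, lt1⟩
    else Quot.mk _ ⟨unskip j q, unskip_lt hj q.2 (by tauto) (by tauto)⟩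
  have hf : ∀ p q, Glued (cup j hj D₁) D₂ p q → f p = f q := by
    rintro ⟨p, hp⟩ ⟨q, hq⟩ (h' | h')
    · simp only [cup] at h'
      by_cases hp1 : p = j ∨ p = j + 1
      · have hq1 : q = j ∨ q = j + 1 := by grind
        simp [f, hp1, hq1]
      · have : q = skip j (D₁.partner (unskip j p)) := by grind
        have h3 := skip_ne j (D₁.partner (unskip j p))
        have hq1 : ¬ (q = j ∨ q = j + 1) := by grind
        simp only [f, hp1, hq1, dif_neg, not_false_eq_true]
        refine Quot.sound (Or.inl ?_)
        simp [this, unskip_skip]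
    · simp only at h'
      have hs : D₂.partner q = p := by rw [← h', D₂.invol]
      by_cases hp1 : p = j ∨ p = j + 1
      · by_cases hq1 : q = j ∨ q = j + 1
        · simp [f, hp1, hq1]
        · simp only [f, hp1, hq1, dif_neg, dif_pos, not_false_eq_true]
          rcases hp1 with rfl | rfl
          · congr
          · simp only [← h']
            exact key
      · by_cases hq1 : q = j ∨ q = j + 1
        · simp only [f, hp1, hq1, dif_neg, dif_pos, not_false_eq_true]
          rcases hq1 with rfl | rfl
          · simp only [← hs]
          · simp only [← hs]
            exact key.symm
        · simp only [f, hp1, hq1, dif_neg, not_false_eq_true]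
          refine Quot.sound (Or.inr ?_)
          simp only [cap]
          rw [skip_unskip (by tauto) (by tauto)]
          simp only [join]
          grind
  rw [loops_eq_card, loops_eq_card]
  refine (Nat.card_congr ⟨skipQuot hj D₁ D₂, Quot.lift f hf, ?_, ?_⟩).symm
  · rintro ⟨p⟩
    have := skip_ne j p
    simp only [skipQuot, f, this, unskip_skip, or_self, dif_neg, not_false_eq_true]
  · rintro ⟨q⟩
    have e : ∀ x y : Fin (N + 2), D₂.partner x = y →
      Quot.mk (Glued (cup j hj D₁) D₂) y = Quot.mk _ x :=
        fun x y h => (Quot.sound (r := Glued (cup j hj D₁) D₂) (Or.inr h)).symm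
    have e' : Quot.mk (Glued (cup j hj D₁) D₂) ⟨j, by omega⟩ = Quot.mk _ ⟨j + 1, by omega⟩ :=
      Quot.sound (Or.inl (by simp [cup]))
    obtain ⟨q, hq⟩ := q
    by_cases hq1 : q = j ∨ q = j + 1
    · simp only [f, hq1, dif_pos, skipQuot]
      have e2 := e ⟨j, by omega⟩ ⟨_, D₂.partner_lt (by omega)⟩ rfl
      simp only [skip_unskip n1 h]
      rcases hq1 with rfl | rfl
      · exact e2
      · exact e2.trans e'
    · simp only [f, hq1, skipQuot, dif_neg, not_false_eq_true]
      simp only [skip_unskip (fun h => hq1 (.inl h)) (fun h => hq1 (.inr h))]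

theorem loops_cup_of_eq (h : D₂.partner j = j + 1) :
    loops (cup j hj D₁) D₂ = loops D₁ (cap j hj D₂) + 1 := by
  have i1 := D₂.invol j
  have i2 := D₂.invol (j + 1)
  -- Here `j, j + 1` form a component of their own, the loop that `cap` drops; `none` stands for it.
  let f : Fin (N + 2) → Option (Quot (Glued D₁ (cap j hj D₂))) := fun q =>
    if hq : (q : ℕ) = j ∨ (q : ℕ) = j + 1 then none
    else some (Quot.mk _ ⟨unskip j q, unskip_lt hj q.2 (by tauto) (by tauto)⟩)
  have hf : ∀ p q, Glued (cup j hj D₁) D₂ p q → f p = f q := by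
    rintro ⟨p, hp⟩ ⟨q, hq⟩ (h' | h')
    · simp only [cup] at h'
      by_cases hp1 : p = j ∨ p = j + 1
      · have hq1 : q = j ∨ q = j + 1 := by grind
        simp [f, hp1, hq1]
      · have : q = skip j (D₁.partner (unskip j p)) := by grind
        have h3 := skip_ne j (D₁.partner (unskip j p))
        have hq1 : ¬ (q = j ∨ q = j + 1) := by grind
        simp only [f, hp1, hq1, dif_neg, not_false_eq_true]
        refine congrArg some (Quot.sound (Or.inl ?_))
        simp [this, unskip_skip]
    · simp only at h'
      have hs : D₂.partner q = p := by rw [← h', D₂.invol]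
      by_cases hp1 : p = j ∨ p = j + 1
      · have hq1 : q = j ∨ q = j + 1 := by grind
        simp [f, hp1, hq1]
      · have hq1 : ¬ (q = j ∨ q = j + 1) := by grind
        simp only [f, hp1, hq1, dif_neg, not_false_eq_true]
        refine congrArg some (Quot.sound (Or.inr ?_))
        simp only [cap]
        rw [skip_unskip (by tauto) (by tauto)]
        simp only [join]
        grind
  rw [loops_eq_card, loops_eq_card, ← Finite.card_option]
  refine (Nat.card_congr ⟨fun x => x.elim (Quot.mk _ ⟨j, by omega⟩) (skipQuot hj D₁ D₂),
    Quot.lift f hf, ?_, ?_⟩).symm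
  · rintro (_ | p)
    · simp [f]
    · induction p using Quot.ind with | mk p
      have := skip_ne j p
      simp only [skipQuot, f, this, unskip_skip, or_self, dif_neg, not_false_eq_true, Option.elim]
  · rintro ⟨q⟩
    have e' : Quot.mk (Glued (cup j hj D₁) D₂) ⟨j, by omega⟩ = Quot.mk _ ⟨j + 1, by omega⟩ :=
      Quot.sound (Or.inl (by simp [cup]))
    obtain ⟨q, hq⟩ := q
    by_cases hq1 : q = j ∨ q = j + 1
    · simp only [f, hq1, dif_pos, Option.elim]
      rcases hq1 with rfl | rfl
      · rfl
      · exact e'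
    · simp only [f, hq1, skipQuot, dif_neg, not_false_eq_true, Option.elim]
      simp only [skip_unskip (fun h => hq1 (.inl h)) (fun h => hq1 (.inr h))]

/-- This is the adjointness of cup and cap at the level of diagrams: the correction term is exactly
the loop that `capMap` records as a factor `d`. Iterated down to no points, it also evaluates the
trace of concrete diagrams. -/
theorem loops_cup : loops (cup j hj D₁) D₂ =
    loops D₁ (cap j hj D₂) + if D₂.partner j = j + 1 then 1 else 0 := by
  split_ifs with h
  · exact loops_cup_of_eq hj D₁ D₂ h
  · exact loops_cup_of_ne hj D₁ D₂ h

end LoopsCup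

theorem loops_zero (D₁ D₂ : TLDiagram 0) : loops D₁ D₂ = 0 := by
  rw [loops_eq_card]
  have : IsEmpty (Quot (Glued D₁ D₂)) := ⟨by rintro ⟨p⟩; exact p.elim0⟩
  exact Nat.card_of_isEmpty

end TLDiagram

noncomputable section

namespace Fib

open TLDiagram

/-! ### The values of `A` and `d`; the sesquilinear trace form -/

theorem kauffmanA_eq_exp : kauffmanA = Complex.exp (((3 * Real.pi / 5 : ℝ) : ℂ) * Complex.I) := by
  have h : Complex.exp (Real.pi / 2 * Complex.I) * Complex.exp (2 * Real.pi * Complex.I / 20) =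
      Complex.exp (((3 * Real.pi / 5 : ℝ) : ℂ) * Complex.I) := by
    rw [← Complex.exp_add]
    congr 1
    push_cast
    ring
  rw [← h, Complex.exp_pi_div_two_mul_I, kauffmanA]

theorem star_kauffmanA : star kauffmanA = kauffmanA⁻¹ := by
  rw [kauffmanA_eq_exp, ← Complex.exp_neg, Complex.star_def, ← Complex.exp_conj,
    map_mul, Complex.conj_I, Complex.conj_ofReal, mul_neg]

theorem kauffmanA_pow_five : kauffmanA ^ 5 = -1 := by
  rw [kauffmanA_eq_exp, ← Complex.exp_nat_mul, ← Complex.exp_pi_mul_I,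
    Complex.exp_eq_exp_iff_exists_int]
  refine ⟨1, ?_⟩
  push_cast
  ring

theorem loopValue_eq : loopValue = ((Real.goldenRatio : ℝ) : ℂ) := by
  rw [loopValue, ← star_kauffmanA, kauffmanA_eq_exp, Complex.star_def, ← Complex.exp_conj,
    map_mul, Complex.conj_I, Complex.conj_ofReal, ← Complex.exp_nat_mul, ← Complex.exp_nat_mul]
  have h : Real.goldenRatio = 2 * Real.cos (Real.pi / 5) := by
    rw [Real.cos_pi_div_five, Real.goldenRatio]; ring
  have h2 : (Real.cos (Real.pi / 5) : ℝ) = - Real.cos (6 * Real.pi / 5) := by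
    rw [← Real.cos_sub_pi]; congr 1; ring
  rw [h, h2]
  push_cast
  rw [Complex.cos]
  ring_nf

theorem loopValue_sq : loopValue ^ 2 = loopValue + 1 := by
  rw [loopValue_eq]
  exact_mod_cast Real.goldenRatio_sq

theorem loopValue_ne_zero : loopValue ≠ 0 := by
  rw [loopValue_eq]
  exact_mod_cast Real.goldenRatio_ne_zero

theorem loopValue_inv : loopValue⁻¹ = loopValue - 1 := by
  refine inv_eq_of_mul_eq_one_right ?_
  linear_combination loopValue_sq

theorem star_loopValue : star loopValue = loopValue := by
  rw [loopValue_eq, Complex.star_def, Complex.conj_ofReal]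

/-- The trace form as a sesquilinear map. -/
def form (N : ℕ) : TLSpace N →ₗ⋆[ℂ] TLSpace N →ₗ[ℂ] ℂ :=
  LinearMap.mk₂'ₛₗ (starRingEnd ℂ) (RingHom.id ℂ) markovInner
    (fun x x' y => by
      unfold markovInner
      rw [Finsupp.sum_add_index']
      · intro D
        simp [Finsupp.sum]
      · intro D a b
        simp [Finsupp.sum, add_mul, Finset.sum_add_distrib])
    (fun c x y => by
      unfold markovInner
      rw [Finsupp.sum_smul_index (by intro D; simp [Finsupp.sum])]
      simp only [Finsupp.sum, smul_eq_mul, Finset.mul_sum, star_mul', starRingEnd_apply]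
      refine Finset.sum_congr rfl fun _ _ => Finset.sum_congr rfl fun _ _ => ?_
      ring)
    (fun x y y' => by
      unfold markovInner
      rw [← Finsupp.sum_add]
      refine Finsupp.sum_congr fun D _ => ?_
      rw [Finsupp.sum_add_index']
      · intro D
        simp
      · intro D a b
        ring)
    (fun c x y => by
      unfold markovInner
      rw [RingHom.id_apply, smul_eq_mul, Finsupp.mul_sum]
      refine Finsupp.sum_congr fun D _ => ?_
      rw [Finsupp.sum_smul_index (by simp), Finsupp.mul_sum]
      refine Finsupp.sum_congr fun D _ => ?_
      ring)

theorem form_apply {N : ℕ} (x y : TLSpace N) : form N x y = markovInner x y := rfl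

theorem form_single {N : ℕ} (D D' : TLDiagram N) (a b : ℂ) :
    form N (.single D a) (.single D' b) = star a * b * loopValue ^ loops D D' := by
  simp [form_apply, markovInner]

/-- Two additive functions of two morphisms agree if they agree on diagrams. -/
theorem ext_diagrams {M N : ℕ} {X : Type*} [AddCommGroup X] {f g : TLSpace M → TLSpace N → X}
    (f1 : ∀ x x' y, f (x + x') y = f x y + f x' y) (f2 : ∀ x y y', f x (y + y') = f x y + f x y')
    (g1 : ∀ x x' y, g (x + x') y = g x y + g x' y) (g2 : ∀ x y y', g x (y + y') = g x y + g x y')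
    (h : ∀ D a D' b, f (.single D a) (.single D' b) = g (.single D a) (.single D' b)) (x y) :
    f x y = g x y := by
  have f0 : ∀ x, f x 0 = 0 := fun x => by simpa using f2 x 0 0
  have f0' : ∀ y, f 0 y = 0 := fun y => by simpa using f1 0 0 y
  have g0 : ∀ x, g x 0 = 0 := fun x => by simpa using g2 x 0 0
  have g0' : ∀ y, g 0 y = 0 := fun y => by simpa using g1 0 0 y
  induction x using Finsupp.induction_linear with
  | zero => rw [f0', g0']
  | add x x' hx hx' => rw [f1, g1, hx, hx']
  | single D a =>
    induction y using Finsupp.induction_linear with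
    | zero => rw [f0, g0]
    | add x x' hx hx' => rw [f2, g2, hx, hx']
    | single D' b => exact h D a D' b

theorem cupMap_single {N j : ℕ} (hj : j ≤ N) (D : TLDiagram N) (c : ℂ) :
    cupMap j hj (.single D c) = .single (cup j hj D) c := by
  simp [cupMap, Finsupp.mapDomain_single]

theorem capMap_single {N j : ℕ} (hj : j ≤ N) (D : TLDiagram (N + 2)) (c : ℂ) :
    capMap j hj (.single D c) =
      .single (cap j hj D) (c * if D.partner j = j + 1 then loopValue else 1) := by
  simp [capMap]

theorem form_symm {N : ℕ} (x y : TLSpace N) : star (form N x y) = form N y x := by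
  refine ext_diagrams (f := fun x y => star (form N x y)) (g := fun x y => form N y x)
    (by simp) (by simp) (by simp) (by simp) ?_ x y
  intro D a D' b
  simp only [form_single, loops_comm D D', star_mul', star_star, star_pow, star_loopValue]
  ring

theorem form_cup_left {N j : ℕ} (hj : j ≤ N) (x : TLSpace N) (y : TLSpace (N + 2)) :
    form (N + 2) (cupMap j hj x) y = form N x (capMap j hj y) := by
  refine ext_diagrams (f := fun x y => form (N + 2) (cupMap j hj x) y)
    (g := fun x y => form N x (capMap j hj y)) (by simp) (by simp) (by simp) (by simp) ?_ x y
  intro D a D' b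
  simp only [cupMap_single, capMap_single, form_single, loops_cup]
  split_ifs
  · ring
  · ring

theorem form_cap_left {N j : ℕ} (hj : j ≤ N) (x : TLSpace (N + 2)) (y : TLSpace N) :
    form N (capMap j hj x) y = form (N + 2) x (cupMap j hj y) := by
  rw [← form_symm, ← form_symm (cupMap j hj y), form_cup_left]

/-- A cap followed by a cup is a product of two mutually adjoint maps, hence self-adjoint. -/
theorem form_tlU {N : ℕ} (j : ℕ) (x y : TLSpace (N + 2)) :
    form (N + 2) (tlU j x) y = form (N + 2) x (tlU j y) := by
  unfold tlU
  split_ifs with hj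
  · simp [form_cup_left, form_cap_left]
  · simp

end Fib

end

namespace TLDiagram

/-! ### Innermost arcs and rotation of diagrams -/

/-- Between the end points of an arc there is an arc that joins adjacent points. -/
theorem exists_innermost {N : ℕ} (D : TLDiagram N) {p : ℕ} (h : p < D.partner p) :
    ∃ j, p ≤ j ∧ j + 1 ≤ D.partner p ∧ D.partner j = j + 1 := by
  induction hk : D.partner p - p using Nat.strong_induction_on generalizing p with
  | _ k ih =>
    by_cases h1 : D.partner p = p + 1
    · exact ⟨p, le_rfl, h1.ge, h1⟩
    · have hN : D.partner p < N := by
        by_contra h2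
        have := D.outside _ (not_lt.1 h2)
        rw [D.invol] at this
        omega
      have i0 := D.invol p
      have i1 := D.invol (p + 1)
      have n1 := D.no_fixed (p + 1) (by omega)
      have c1 := D.noncrossing p (p + 1) (by omega) (by omega)
      have c2 := D.noncrossing (D.partner (p + 1)) p
      have e1 : D.partner (p + 1) ≠ D.partner p := fun h => by grind
      have e2 : D.partner (p + 1) ≠ p := fun h => by grind
      have e3 : ¬ D.partner (p + 1) < p := fun h => by grind
      -- By noncrossing, the arc that starts at `p + 1` stays under the arc of `p` and is shorter.
      obtain ⟨j, hj1, hj2, hj3⟩ := ih (D.partner (p + 1) - (p + 1)) (by omega) (by omega) rfl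
      exact ⟨j, by omega, by omega, hj3⟩

/-- An arc joins adjacent points among the first four points, or among the others, or the points `3`
and `4`. -/
theorem exists_adjacent {N : ℕ} (hN : 2 ≤ N) (D : TLDiagram (N + 2)) :
    (∃ j ≤ 2, D.partner j = j + 1) ∨ (∃ j, 4 ≤ j ∧ j ≤ N ∧ D.partner j = j + 1) ∨
      D.partner 3 = 4 := by
  have h3 := D.no_fixed 3 (by omega)
  have i3 := D.invol 3
  have i4 := D.invol 4
  have l3 := D.partner_lt (p := 3) (by omega)
  rcases lt_or_gt_of_ne h3 with h | h
  · obtain ⟨j, hj1, hj2, hj3⟩ := D.exists_innermost (p := D.partner 3) (by omega)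
    exact Or.inl ⟨j, by omega, hj3⟩
  · by_cases h4 : D.partner 3 = 4
    · exact Or.inr (Or.inr h4)
    · have n4 := D.no_fixed 4 (by omega)
      have l4 := D.partner_lt (p := 4) (by omega)
      rcases lt_or_gt_of_ne n4 with h' | h'
      · have := D.noncrossing (D.partner 4) 3
        grind
      · obtain ⟨j, hj1, hj2, hj3⟩ := D.exists_innermost h'
        exact Or.inr (Or.inl ⟨j, by omega, by omega, hj3⟩)

theorem cap_cup {N j : ℕ} (hj : j ≤ N) (D : TLDiagram N) : cap j hj (cup j hj D) = D := by
  ext q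
  have h1 := skip_ne j q
  have h2 := skip_ne j (D.partner q)
  simp [cap, cup, join, h1, h2, unskip_skip]

theorem cup_partner {N j : ℕ} (hj : j ≤ N) (D : TLDiagram N) (q : ℕ) : (cup j hj D).partner q =
    if q = j then j + 1 else if q = j + 1 then j else skip j (D.partner (unskip j q)) := rfl

/-- The two operations take place at disjoint points. Inserting points to the right of `i, i + 1`
leaves their numbers unchanged, which is why only this order is treated; other positions are reached
by rotation. -/
theorem cup_hook {N i j : ℕ} (hij : i + 2 ≤ j) (hj : j ≤ N + 2) (D : TLDiagram (N + 2)) :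
    cup j hj (cup i (by omega) (cap i (by omega) D)) =
      cup i (by omega) (cap i (by omega) (cup j hj D)) := by
  ext q
  have h1 : skip j i = i := by unfold skip; grind
  have h2 : skip j (i + 1) = i + 1 := by unfold skip; grind
  have h3 : unskip j i = i := by unfold unskip; grind
  have h4 : unskip j (i + 1) = i + 1 := by unfold unskip; grind
  have n1 : i ≠ j := by omega
  have n2 : i ≠ j + 1 := by omega
  have n3 : i + 1 ≠ j := by omega
  have n4 : i + 1 ≠ j + 1 := by omega
  rw [hook_partner]
  unfold join
  simp only [cup_partner, h3, h4, n1, n2, n3, n4, if_false]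
  by_cases hq : q = j ∨ q = j + 1
  · have := n1.symm
    have := n3.symm
    grind
  · obtain ⟨r, rfl⟩ : ∃ r, q = skip j r := ⟨unskip j q, (skip_unskip (by tauto) (by tauto)).symm⟩
    have e1 : skip j r = i ↔ r = i := by rw [← skip_inj (j := j) (p := r), h1]
    have e2 : skip j r = i + 1 ↔ r = i + 1 := by rw [← skip_inj (j := j) (p := r), h2]
    have e3 : skip j (D.partner r) = i ↔ D.partner r = i := by
      rw [← skip_inj (j := j) (p := D.partner r), h1]
    have e4 : skip j (D.partner r) = i + 1 ↔ D.partner r = i + 1 := by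
      rw [← skip_inj (j := j) (p := D.partner r), h2]
    have e := skip_ne j r
    simp only [e.1, e.2, if_false, unskip_skip, e1, e2, e3, e4]
    have : (cup i (by omega) (cap i (by omega) D)).partner r =
      if r = i then i + 1 else if r = i + 1 then i else join D.partner i r := hook_partner _ _ _
    rw [cup_partner] at this
    rw [this]
    unfold join
    split_ifs <;> simp only [h1, h2]

/-- Rotation of the numbering of the points. -/
def rotUp (N p : ℕ) : ℕ := if p < N + 1 then p + 1 else if p = N + 1 then 0 else p

/-- The inverse rotation of the numbering. -/
def rotDown (N p : ℕ) : ℕ := if p = 0 then N + 1 else if p < N + 2 then p - 1 else p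

theorem rotUp_rotDown (N p : ℕ) : rotUp N (rotDown N p) = p := by
  unfold rotUp rotDown; grind

theorem rotDown_rotUp (N p : ℕ) : rotDown N (rotUp N p) = p := by
  unfold rotUp rotDown; grind

theorem rotUp_lt {N p : ℕ} : rotUp N p < N + 2 ↔ p < N + 2 := by
  unfold rotUp; grind

/-- Rotation of a diagram. -/
def rot {N : ℕ} (D : TLDiagram (N + 2)) : TLDiagram (N + 2) where
  partner p := rotDown N (D.partner (rotUp N p))
  invol p := by rw [rotUp_rotDown, D.invol, rotDown_rotUp]
  no_fixed p hp h := by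
    refine D.no_fixed (rotUp N p) (rotUp_lt.2 hp) ?_
    rw [← rotUp_rotDown N (D.partner _), h]
  outside p hp := by
    rw [D.outside _ (by rwa [← not_lt, rotUp_lt, not_lt]), rotDown_rotUp]
  noncrossing p q hpq h1 h2 := by
    have o := D.outside
    have lt := @TLDiagram.partner_lt _ D
    have i1 := D.invol (rotUp N p)
    have i2 := D.invol (rotUp N q)
    have nc1 := D.noncrossing (rotUp N p) (rotUp N q)
    have nc2 := D.noncrossing 0 (rotUp N p)
    have hq : q < N + 2 := by
      by_contra hq
      have := o (rotUp N q) (by rwa [← not_lt, rotUp_lt])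
      unfold rotUp rotDown at *
      grind
    have lp := lt (p := rotUp N p) (rotUp_lt.2 (by omega))
    have lq := lt (p := rotUp N q) (rotUp_lt.2 (by omega))
    generalize D.partner (rotUp N p) = P at *
    generalize hQ : D.partner (rotUp N q) = Q at *
    have : rotUp N p = p + 1 := by unfold rotUp; grind
    by_cases hq' : q = N + 1
    · unfold rotDown at h1; grind
    have : rotUp N q = q + 1 := by unfold rotUp; grind
    unfold rotDown at h1 h2
    grind

/-- A common renumbering of both matchings is an isomorphism of the glued graphs. -/
theorem loops_rot {N : ℕ} (D₁ D₂ : TLDiagram (N + 2)) : loops (rot D₁) (rot D₂) = loops D₁ D₂ := by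
  let e : Fin (N + 2) ≃ Fin (N + 2) :=
    ⟨fun p => ⟨rotUp N p, rotUp_lt.2 p.2⟩,
      fun p => ⟨rotDown N p, by rw [← rotUp_lt, rotUp_rotDown]; exact p.2⟩,
      fun p => Fin.ext (rotDown_rotUp N p), fun p => Fin.ext (rotUp_rotDown N p)⟩
  refine Nat.card_congr (Quot.congr e fun p q => ?_)
  have h : ∀ D : TLDiagram (N + 2), (rot D).partner p = q ↔ D.partner (e p) = e q := by
    intro D
    simp only [rot, e, Equiv.coe_fn_mk]
    constructor
    · intro h
      rw [← h, rotUp_rotDown]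
    · intro h
      rw [h, rotDown_rotUp]
  rw [h, h]

theorem rot_partner_eq {N j : ℕ} (hj : j + 1 ≤ N) (D : TLDiagram (N + 2)) :
    (rot D).partner j = j + 1 ↔ D.partner (j + 1) = j + 2 := by
  simp only [rot]
  have : rotUp N j = j + 1 := by unfold rotUp; grind
  rw [this]
  unfold rotDown
  have := D.partner_lt (p := j + 1) (by omega)
  grind

theorem rot_hook {N j : ℕ} (hj : j + 1 ≤ N) (D : TLDiagram (N + 2)) :
    rot (cup (j + 1) hj (cap (j + 1) hj D)) =
      cup j (by omega) (cap j (by omega) (rot D)) := by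
  refine ext_of_lt fun p hp => ?_
  rw [hook_partner]
  simp only [rot, hook_partner, join]
  have h1 : rotUp N j = j + 1 := by unfold rotUp; grind
  have h2 : rotUp N (j + 1) = j + 2 := by unfold rotUp; grind
  have h3 : ∀ q, rotDown N q = j ↔ q = j + 1 := by unfold rotDown; grind
  have h4 : ∀ q, rotDown N q = j + 1 ↔ q = j + 2 := by unfold rotDown; grind
  have h5 : ∀ q, rotUp N q = j + 1 ↔ q = j := by unfold rotUp; grind
  have h6 : ∀ q, rotUp N q = j + 1 + 1 ↔ q = j + 1 := by unfold rotUp; grind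
  simp only [h1, h2, h3, h4, h5, h6]
  split_ifs <;> first | rfl | (unfold rotDown; grind)

end TLDiagram

noncomputable section

namespace Fib

open TLDiagram

section Projector

/-! ### Jones–Wenzl projectors at the Fibonacci value -/

theorem delta_two : delta 2 = loopValue := by
  simp only [delta]
  linear_combination loopValue_sq

theorem delta_three : delta 3 = 1 := by
  have h : delta 3 = loopValue * delta 2 - delta 1 := rfl
  rw [h, delta_two]
  simp only [delta]
  linear_combination loopValue_sq

variable {R : Type*} [Ring R] [Algebra ℂ R] (u : ℕ → R) (s : ℕ)

theorem jonesWenzl_two : jonesWenzl u s 2 = 1 - loopValue⁻¹ • u s := by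
  simp [jonesWenzl, delta]

theorem jonesWenzl_three :
    jonesWenzl u s 3 = jonesWenzl u s 2 - jonesWenzl u s 2 * u (s + 1) * jonesWenzl u s 2 := by
  have h : jonesWenzl u s 3 = jonesWenzl u s 2 -
    (delta 1 / delta 2) • (jonesWenzl u s 2 * u (s + 1) * jonesWenzl u s 2) := rfl
  rw [h, delta_two]
  simp [delta, loopValue_ne_zero]

theorem jonesWenzl_four : jonesWenzl u s 4 =
    jonesWenzl u s 3 - loopValue • (jonesWenzl u s 3 * u (s + 2) * jonesWenzl u s 3) := by
  have h : jonesWenzl u s 4 = jonesWenzl u s 3 -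
    (delta 2 / delta 3) • (jonesWenzl u s 3 * u (s + 2) * jonesWenzl u s 3) := rfl
  rw [h, delta_two, delta_three, div_one]

variable {u s}

theorem semiconjBy_jonesWenzl {t a : ℕ} {x : R}
    (h : ∀ k, k + 2 ≤ a → SemiconjBy x (u (s + k)) (u (t + k))) :
    SemiconjBy x (jonesWenzl u s a) (jonesWenzl u t a) := by
  induction a using Nat.strong_induction_on with
  | _ a ih =>
    match a with
    | 0 => exact SemiconjBy.one_right _
    | 1 => exact SemiconjBy.one_right _
    | a + 2 =>
      have e := ih (a + 1) (by omega) fun k hk => h k (by omega)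
      exact e.sub_right (((e.mul_right (h a le_rfl)).mul_right e).smul_right _)

variable (h0 : u s * u s = loopValue • u s)

include h0

theorem mul_jonesWenzl_two : u s * jonesWenzl u s 2 = 0 := by
  rw [jonesWenzl_two, mul_sub, mul_one, mul_smul_comm, h0, inv_smul_smul₀ loopValue_ne_zero,
    sub_self]

theorem jonesWenzl_two_mul : jonesWenzl u s 2 * u s = 0 := by
  rw [jonesWenzl_two, sub_mul, one_mul, smul_mul_assoc, h0, inv_smul_smul₀ loopValue_ne_zero,
    sub_self]

theorem jonesWenzl_two_sq : jonesWenzl u s 2 * jonesWenzl u s 2 = jonesWenzl u s 2 := by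
  conv_lhs => lhs; rw [jonesWenzl_two]
  rw [sub_mul, one_mul, smul_mul_assoc, mul_jonesWenzl_two h0, smul_zero, sub_zero]

theorem jonesWenzl_two_mul_three :
    jonesWenzl u s 2 * jonesWenzl u s 3 = jonesWenzl u s 3 := by
  rw [jonesWenzl_three, mul_sub, ← mul_assoc, ← mul_assoc, jonesWenzl_two_sq h0]

theorem jonesWenzl_three_mul_two :
    jonesWenzl u s 3 * jonesWenzl u s 2 = jonesWenzl u s 3 := by
  rw [jonesWenzl_three, sub_mul, mul_assoc _ _ (jonesWenzl u s 2), jonesWenzl_two_sq h0]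

variable (h1 : u (s + 1) * u (s + 1) = loopValue • u (s + 1))
  (h10 : u (s + 1) * u s * u (s + 1) = u (s + 1))

include h1 h10

-- The instance `n = 2` of `u p_n u = (Δ_n/Δ_{n-1}) p_{n-1} u`; the factor is `d - d⁻¹ = 1`.
omit h0 in
theorem conj_jonesWenzl_two : u (s + 1) * jonesWenzl u s 2 * u (s + 1) = u (s + 1) := by
  rw [jonesWenzl_two, mul_sub, sub_mul, mul_one, mul_smul_comm, smul_mul_assoc, h10, h1, ← sub_smul,
    loopValue_inv, sub_sub_cancel, one_smul]

omit h0 in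
theorem mul_jonesWenzl_three : u (s + 1) * jonesWenzl u s 3 = 0 := by
  rw [jonesWenzl_three, mul_sub, ← mul_assoc, ← mul_assoc, conj_jonesWenzl_two h1 h10, sub_self]

theorem jonesWenzl_three_sq : jonesWenzl u s 3 * jonesWenzl u s 3 = jonesWenzl u s 3 := by
  conv_lhs => lhs; rw [jonesWenzl_three]
  rw [sub_mul, mul_assoc, jonesWenzl_two_mul_three h0, mul_assoc, mul_jonesWenzl_three h1 h10,
    mul_zero, sub_zero]

omit h0 in
theorem jonesWenzl_three_mul : jonesWenzl u s 3 * u (s + 1) = 0 := by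
  rw [jonesWenzl_three, sub_mul, mul_assoc (_ * _) _ (u (s + 1)), mul_assoc _ (u (s + 1)),
    ← mul_assoc (u (s + 1)), conj_jonesWenzl_two h1 h10, sub_self]

variable (h2 : u (s + 2) * u (s + 2) = loopValue • u (s + 2))
  (h21 : u (s + 2) * u (s + 1) * u (s + 2) = u (s + 2)) (h02 : u s * u (s + 2) = u (s + 2) * u s)

include h2 h21 h02

-- The instance `n = 3` of the same identity, with factor `Δ₃/Δ₂ = d⁻¹`. It cancels the coefficient
-- `d` in `jonesWenzl_four`, which makes `p_4` annihilate `u (s + 2)`.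
omit h1 h10 in
theorem conj_jonesWenzl_three : u (s + 2) * jonesWenzl u s 3 * u (s + 2) =
    loopValue⁻¹ • (jonesWenzl u s 2 * u (s + 2)) := by
  have hc : u (s + 2) * jonesWenzl u s 2 = jonesWenzl u s 2 * u (s + 2) := by
    simp [jonesWenzl_two, mul_sub, sub_mul, h02]
  have e1 : u (s + 2) * jonesWenzl u s 2 * u (s + 2) =
      loopValue • (jonesWenzl u s 2 * u (s + 2)) := by
    rw [hc, mul_assoc, h2, mul_smul_comm]
  have e2 : u (s + 2) * (jonesWenzl u s 2 * u (s + 1) * jonesWenzl u s 2) * u (s + 2) =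
      jonesWenzl u s 2 * u (s + 2) := by
    calc _ = (u (s + 2) * jonesWenzl u s 2) * u (s + 1) * (jonesWenzl u s 2 * u (s + 2)) := by
          simp only [mul_assoc]
      _ = (jonesWenzl u s 2 * u (s + 2)) * u (s + 1) * (u (s + 2) * jonesWenzl u s 2) := by
          rw [hc]
      _ = jonesWenzl u s 2 * (u (s + 2) * u (s + 1) * u (s + 2)) * jonesWenzl u s 2 := by
          simp only [mul_assoc]
      _ = jonesWenzl u s 2 * u (s + 2) := by
          rw [h21, mul_assoc, hc, ← mul_assoc, jonesWenzl_two_sq h0]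
  rw [jonesWenzl_three, mul_sub, sub_mul, e1, e2, loopValue_inv, sub_smul, one_smul]

theorem mul_jonesWenzl_four {j : ℕ} (hj : s ≤ j) (hj' : j ≤ s + 2) :
    u j * jonesWenzl u s 4 = 0 := by
  have hc : u (s + 2) * jonesWenzl u s 2 = jonesWenzl u s 2 * u (s + 2) := by
    simp [jonesWenzl_two, mul_sub, sub_mul, h02]
  have key : ∀ x, x * jonesWenzl u s 3 = 0 → x * jonesWenzl u s 4 = 0 := by
    intro x hx
    rw [jonesWenzl_four, mul_sub, mul_smul_comm, ← mul_assoc, ← mul_assoc, hx]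
    simp
  obtain rfl | rfl | rfl : j = s ∨ j = s + 1 ∨ j = s + 2 := by omega
  · refine key _ ?_
    rw [← jonesWenzl_two_mul_three h0, ← mul_assoc, mul_jonesWenzl_two h0, zero_mul]
  · exact key _ (mul_jonesWenzl_three h1 h10)
  · rw [jonesWenzl_four, mul_sub, mul_smul_comm, ← mul_assoc, ← mul_assoc,
      conj_jonesWenzl_three h0 h2 h21 h02, smul_mul_assoc, smul_inv_smul₀ loopValue_ne_zero, ← hc,
      mul_assoc, jonesWenzl_two_mul_three h0, sub_self]

theorem jonesWenzl_four_mul {j : ℕ} (hj : s ≤ j) (hj' : j ≤ s + 2) :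
    jonesWenzl u s 4 * u j = 0 := by
  have key : ∀ x, jonesWenzl u s 3 * x = 0 → jonesWenzl u s 4 * x = 0 := by
    intro x hx
    rw [jonesWenzl_four, sub_mul, smul_mul_assoc, mul_assoc, hx]
    simp
  obtain rfl | rfl | rfl : j = s ∨ j = s + 1 ∨ j = s + 2 := by omega
  · refine key _ ?_
    rw [← jonesWenzl_three_mul_two h0, mul_assoc, jonesWenzl_two_mul h0, mul_zero]
  · exact key _ (jonesWenzl_three_mul h1 h10)
  · rw [jonesWenzl_four, sub_mul, smul_mul_assoc, mul_assoc, mul_assoc, ← mul_assoc (u (s + 2)),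
      conj_jonesWenzl_three h0 h2 h21 h02, mul_smul_comm, smul_inv_smul₀ loopValue_ne_zero,
      ← mul_assoc, jonesWenzl_three_mul_two h0, sub_self]

end Projector

/-! ### The ideal of `p_4` lies in the radical of the trace form -/

theorem tlU_apply {N j : ℕ} (hj : j ≤ N) (x : TLSpace (N + 2)) :
    tlU j x = cupMap j hj (capMap j hj x) := by
  simp [tlU, hj]

theorem capMap_cupMap {N j : ℕ} (hj : j ≤ N) (x : TLSpace N) :
    capMap j hj (cupMap j hj x) = loopValue • x := by
  induction x using Finsupp.induction_linear with
  | zero => simp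
  | add x y hx hy => simp [hx, hy]
  | single D a =>
    rw [cupMap_single, capMap_single, cap_cup]
    simp [cup, mul_comm]

theorem cupMap_injective {N j : ℕ} (hj : j ≤ N) : Function.Injective (cupMap j hj) := by
  intro x y h
  have := congrArg (capMap j hj) h
  rw [capMap_cupMap, capMap_cupMap] at this
  exact smul_right_injective _ loopValue_ne_zero this

theorem tlU_cupMap {N i j : ℕ} (hij : i + 2 ≤ j) (hj : j ≤ N + 2) (x : TLSpace (N + 2)) :
    tlU i (cupMap j hj x) = cupMap j hj (tlU i x) := by
  induction x using Finsupp.induction_linear with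
  | zero => simp
  | add x y hx hy => simp [hx, hy]
  | single D a =>
    have h : (cup j hj D).partner i = i + 1 ↔ D.partner i = i + 1 := by
      have h1 : unskip j i = i := by unfold unskip; grind
      have h2 : i ≠ j := by omega
      have h3 : i ≠ j + 1 := by omega
      simp only [cup, h1, h2, h3, if_false]
      unfold skip
      grind
    rw [tlU_single (by omega), cupMap_single, cupMap_single, tlU_single (by omega), cup_hook hij hj]
    simp only [h]

theorem capMap_tlU {N i j : ℕ} (hij : i + 2 ≤ j) (hj : j ≤ N + 2) (x : TLSpace (N + 2 + 2)) :
    capMap j hj (tlU i x) = tlU i (capMap j hj x) := by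
  apply cupMap_injective hj
  rw [← tlU_apply, ← tlU_cupMap hij, ← tlU_apply]
  exact (LinearMap.congr_fun (tlU_comm hij) x).symm

/-- A zigzag straightens. It is read off from `u_{j+1} u_j u_{j+1} = u_{j+1}`, by cancelling the
injective outer cup and the loop factor. -/
theorem capMap_tlU_cupMap {N j : ℕ} (hj : j + 1 ≤ N) (x : TLSpace N) :
    capMap (j + 1) hj (tlU j (cupMap (j + 1) hj x)) = x := by
  apply cupMap_injective hj
  refine smul_right_injective _ loopValue_ne_zero ?_
  have := LinearMap.congr_fun (tlU_down hj) (cupMap (j + 1) hj x)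
  simp only [Module.End.mul_apply] at this
  rw [tlU_apply hj (tlU j _), tlU_apply hj (cupMap _ _ _), capMap_cupMap] at this
  simpa using this

/-- Rotation of morphisms. -/
def rotMap {N : ℕ} : Module.End ℂ (TLSpace (N + 2)) := Finsupp.lmapDomain ℂ ℂ rot

theorem rotMap_single {N : ℕ} (D : TLDiagram (N + 2)) (c : ℂ) :
    rotMap (.single D c) = .single (rot D) c := by
  simp [rotMap, Finsupp.mapDomain_single]

theorem form_rotMap {N : ℕ} (x y : TLSpace (N + 2)) :
    form _ (rotMap x) (rotMap y) = form _ x y := by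
  refine ext_diagrams (f := fun x y => form _ (rotMap x) (rotMap y))
    (g := fun x y => form _ x y) (by simp) (by simp) (by simp) (by simp) ?_ x y
  intro D a D' b
  simp only [rotMap_single, form_single, loops_rot]

theorem rotMap_tlU {N j : ℕ} (hj : j + 1 ≤ N) :
    (rotMap * tlU (j + 1) : Module.End ℂ (TLSpace (N + 2))) = tlU j * rotMap := by
  refine Finsupp.lhom_ext fun D c => ?_
  simp only [Module.End.mul_apply, tlU_single hj, rotMap_single, tlU_single (show j ≤ N by omega),
    rot_hook hj, rot_partner_eq hj]

theorem rotMap_jonesWenzl {N s : ℕ} (hs : s + 3 ≤ N) :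
    (rotMap * jonesWenzl tlU (s + 1) 4 : Module.End ℂ (TLSpace (N + 2))) =
      jonesWenzl tlU s 4 * rotMap := by
  refine (semiconjBy_jonesWenzl (R := Module.End ℂ (TLSpace (N + 2))) fun k hk => ?_).eq
  rw [add_right_comm]
  exact rotMap_tlU (by omega)

theorem tlU_mul_jonesWenzl {N s j : ℕ} (hs : s + 2 ≤ N) (hj : s ≤ j) (hj' : j ≤ s + 2) :
    (tlU j * jonesWenzl tlU s 4 : Module.End ℂ (TLSpace (N + 2))) = 0 :=
  mul_jonesWenzl_four (tlU_mul_self _) (tlU_mul_self _) (tlU_down (by omega)) (tlU_mul_self _)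
    (tlU_down (by omega)) (tlU_comm (by omega)) hj hj'

theorem jonesWenzl_mul_tlU {N s j : ℕ} (hs : s + 2 ≤ N) (hj : s ≤ j) (hj' : j ≤ s + 2) :
    (jonesWenzl tlU s 4 * tlU j : Module.End ℂ (TLSpace (N + 2))) = 0 :=
  jonesWenzl_four_mul (tlU_mul_self _) (tlU_mul_self _) (tlU_down (by omega)) (tlU_mul_self _)
    (tlU_down (by omega)) (tlU_comm (by omega)) hj hj'

theorem jonesWenzl_cupMap {N j a : ℕ} (ha : a ≤ j) (hj : j ≤ N + 2) (x : TLSpace (N + 2)) :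
    jonesWenzl tlU 0 a (cupMap j hj x) = cupMap j hj (jonesWenzl tlU 0 a x) := by
  induction a using Nat.strong_induction_on generalizing x with
  | _ a ih =>
    match a with
    | 0 => rfl
    | 1 => rfl
    | a + 2 =>
      have h := fun x => ih (a + 1) (by omega) (by omega) x
      simp only [jonesWenzl, LinearMap.sub_apply, LinearMap.smul_apply, Module.End.mul_apply,
        map_sub, map_smul, h, zero_add]
      rw [tlU_cupMap (by omega), h]

theorem jonesWenzl_capMap {N j a : ℕ} (ha : a ≤ j) (hj : j ≤ N + 2) (x : TLSpace (N + 2 + 2)) :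
    capMap j hj (jonesWenzl tlU 0 a x) = jonesWenzl tlU 0 a (capMap j hj x) := by
  induction a using Nat.strong_induction_on generalizing x with
  | _ a ih =>
    match a with
    | 0 => rfl
    | 1 => rfl
    | a + 2 =>
      have h := fun x => ih (a + 1) (by omega) (by omega) x
      simp only [jonesWenzl, LinearMap.sub_apply, LinearMap.smul_apply, Module.End.mul_apply,
        map_sub, map_smul, h, zero_add]
      rw [capMap_tlU (by omega), h]

/-- The partial trace of `p_4` vanishes. -/
theorem capMap_jonesWenzl_cupMap {N : ℕ} (hN : 3 ≤ N + 2) (x : TLSpace (N + 2)) :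
    capMap 3 hN (jonesWenzl tlU 0 4 (cupMap 3 hN x)) = 0 := by
  rw [jonesWenzl_four]
  simp only [LinearMap.sub_apply, LinearMap.smul_apply, Module.End.mul_apply, map_sub, map_smul,
    zero_add]
  -- Closing the fourth strand turns the first term into `d p_3` and the second into `d p_3 p_3`.
  rw [jonesWenzl_cupMap le_rfl, capMap_cupMap, jonesWenzl_capMap le_rfl, capMap_tlU_cupMap hN]
  have h : (jonesWenzl tlU 0 3 * jonesWenzl tlU 0 3 : Module.End ℂ (TLSpace (N + 2))) =
      jonesWenzl tlU 0 3 :=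
    jonesWenzl_three_sq (tlU_mul_self _) (tlU_mul_self _) (tlU_down (by omega))
  rw [← Module.End.mul_apply, h, sub_self]

theorem single_eq_tlU {N j : ℕ} (hj : j ≤ N) {D : TLDiagram (N + 2)} (h : D.partner j = j + 1)
    (a : ℂ) : Finsupp.single D a = loopValue⁻¹ • tlU j (.single D a) := by
  rw [tlU_single hj, hook_of_eq hj D h, if_pos h, Finsupp.smul_single, smul_eq_mul]
  congr 1
  field_simp [loopValue_ne_zero]

theorem single_eq_cupMap {N j : ℕ} (hj : j ≤ N) {D : TLDiagram (N + 2)} (h : D.partner j = j + 1)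
    (a : ℂ) : Finsupp.single D a = cupMap j hj (.single (cap j hj D) a) := by
  rw [cupMap_single, hook_of_eq hj D h]

/-- For diagrams `D`, `D'`, an arc between adjacent points among the first four is annihilated by
`p_4`. An arc between adjacent points beyond them commutes with `p_4` and can be moved across the
form, which lowers `N`. If neither diagram gives such an arc, both join the points `3` and `4`, and
the partial trace of `p_4` appears. -/
theorem form_jonesWenzl_zero {N : ℕ} (hN : 2 ≤ N) (x y : TLSpace (N + 2)) :
    form _ (jonesWenzl tlU 0 4 x) y = 0 := by
  induction N using Nat.strong_induction_on with
  | _ N ih =>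
  obtain ⟨M, rfl⟩ : ∃ M, N = M + 2 := ⟨N - 2, by omega⟩
  refine ext_diagrams (f := fun x y => form _ (jonesWenzl tlU 0 4 x) y)
    (g := fun _ _ => (0 : ℂ)) (by simp) (by simp) (by simp) (by simp) ?_ x y
  intro D a D' b
  rcases D.exists_adjacent hN with ⟨j, hj, h⟩ | ⟨j, hj1, hj2, h⟩ | h
  · rw [single_eq_tlU (by omega) h, map_smul, ← Module.End.mul_apply,
      jonesWenzl_mul_tlU (by omega) (by omega) (by omega)]
    simp
  · rw [single_eq_cupMap hj2 h, jonesWenzl_cupMap hj1, form_cup_left]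
    exact ih M (by omega) (by omega) _ _
  rcases D'.exists_adjacent hN with ⟨j, hj, h'⟩ | ⟨j, hj1, hj2, h'⟩ | h'
  · rw [single_eq_tlU (by omega) h', map_smul, ← form_tlU, ← Module.End.mul_apply,
      tlU_mul_jonesWenzl (by omega) (by omega) (by omega)]
    simp
  · rw [single_eq_cupMap hj2 h', ← form_cap_left, jonesWenzl_capMap hj1]
    exact ih M (by omega) (by omega) _ _
  have h3 : 3 ≤ M + 2 := by
    have := D.partner_lt (p := 3) (by omega)
    omega
  rw [single_eq_cupMap h3 h, single_eq_cupMap h3 h', ← form_cap_left, capMap_jonesWenzl_cupMap]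
  simp

/-- The form is invariant under rotation, and a rotation by one point lowers the position of the
projector by one. -/
theorem form_jonesWenzl {N s : ℕ} (hs : s + 2 ≤ N) (x y : TLSpace (N + 2)) :
    form _ (jonesWenzl tlU s 4 x) y = 0 := by
  induction s generalizing x y with
  | zero => exact form_jonesWenzl_zero (by omega) x y
  | succ s ih =>
    have e : rotMap (jonesWenzl tlU (s + 1) 4 x) = jonesWenzl tlU s 4 (rotMap x) :=
      LinearMap.congr_fun (rotMap_jonesWenzl (by omega)) x
    rw [← form_rotMap (jonesWenzl tlU (s + 1) 4 x) y, e]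
    exact ih (by omega) _ _

/-- The ideal generated by `p_4` is contained in the radical of the trace form. -/
theorem form_null {N : ℕ} {x : TLSpace N} (hx : IsNull N x) (y : TLSpace N) : form N x y = 0 := by
  induction hx with
  | proj s hs x => exact form_jonesWenzl (by omega) x y
  | cup j hj _ ih => rw [form_cup_left, ih]
  | cap j hj _ ih => rw [form_cap_left, ih]
  | zero => simp
  | add _ _ h1 h2 => simp [h1, h2]
  | smul c _ h => simp [h]

/-- The trace form on the Temperley-Lieb-Jones category. -/
def formQ (N : ℕ) : TLJSpace N →ₗ⋆[ℂ] TLJSpace N →ₗ[ℂ] ℂ :=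
  ((nullSpace N).liftQ (((nullSpace N).liftQ (form N) (fun x hx => by
    exact LinearMap.ext fun y => form_null hx y)).flip) (fun y hy => by
      rw [LinearMap.mem_ker]
      refine LinearMap.ext fun q => ?_
      obtain ⟨x, rfl⟩ := Submodule.Quotient.mk_surjective _ q
      -- Hermitian symmetry turns the left radical into the right one.
      have : form N x y = 0 := by rw [← form_symm, form_null hy, star_zero]
      exact this)).flip

theorem formQ_mk {N : ℕ} (x y : TLSpace N) :
    formQ N ((nullSpace N).mkQ x) ((nullSpace N).mkQ y) = form N x y := rfl

end Fib

end

namespace TLDiagram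

/-! ### Enumeration of the diagrams that survive the colouring -/

/-- The cup-cap diagram at the points `j`, `j + 1` on top of a diagram. -/
def hook {N : ℕ} (j : ℕ) (hj : j ≤ N) (D : TLDiagram (N + 2)) : TLDiagram (N + 2) :=
  cup j hj (cap j hj D)

/-- The diagram without points. -/
def empty : TLDiagram 0 where
  partner p := p
  invol _ := rfl
  no_fixed _ h := absurd h (Nat.not_lt_zero _)
  outside _ _ := rfl
  noncrossing _ _ h h' := absurd h' h.not_gt

/-- The arcs are `0-3, 1-2, 4-7, 5-6`: the first two coloured points are joined to each other, the
third to the bottom point. -/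
def D₁ : TLDiagram 8 :=
  cup 5 (by decide) (cup 4 (by decide) (cup 1 (by decide) (cup 0 (by decide) empty)))

/-- The arcs are `0-7, 1-6, 2-5, 3-4`: the last two top points are joined to each other, the first
to the bottom point. -/
def D₂ : TLDiagram 8 :=
  cup 3 (by decide) (cup 2 (by decide) (cup 1 (by decide) (cup 0 (by decide) empty)))

/-- The arcs are `0-7, 1-2, 3-4, 5-6`: each coloured point is joined once to each of its two cyclic
neighbours. -/
def D₃ : TLDiagram 8 :=
  cup 5 (by decide) (cup 3 (by decide) (cup 1 (by decide) (cup 0 (by decide) empty)))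

/-- An innermost arc can be removed. Iterating, every diagram is a sequence of cups over the empty
one, so the diagrams with six or eight points form a finite list that can be checked by evaluation.
-/
theorem exists_cup {N : ℕ} (D : TLDiagram (N + 2)) :
    ∃ (j : Fin (N + 1)) (D' : TLDiagram N), D = cup j (Nat.le_of_lt_succ j.2) D' := by
  have h0 := D.no_fixed 0 (by omega)
  have hl := D.partner_lt (p := 0) (by omega)
  obtain ⟨j, -, hj, h⟩ := D.exists_innermost (p := 0) (by omega)
  exact ⟨⟨j, by omega⟩, _, (hook_of_eq (by omega) D h).symm⟩

theorem eq_empty (D : TLDiagram 0) : D = empty := ext_of_lt fun p hp => absurd hp (Nat.not_lt_zero p)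

/-- The diagram that joins each of three pairs of points to the two others. -/
def triangle : TLDiagram 6 :=
  cup 3 (by decide) (cup 1 (by decide) (cup 0 (by decide) empty))

theorem six_cases (D : TLDiagram 6) :
    D.partner 0 = 1 ∨ D.partner 2 = 3 ∨ D.partner 4 = 5 ∨ D = triangle := by
  obtain ⟨j, D, rfl⟩ := exists_cup D
  obtain ⟨k, D, rfl⟩ := exists_cup D
  obtain ⟨l, D, rfl⟩ := exists_cup D
  obtain rfl := eq_empty D
  have h : ∀ (j : Fin 5) (k : Fin 3) (l : Fin 1) (hj : (j : ℕ) ≤ 4) (hk : (k : ℕ) ≤ 2)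
      (hl : (l : ℕ) ≤ 0), (cup j hj (cup k hk (cup l hl empty))).partner 0 = 1 ∨
      (cup j hj (cup k hk (cup l hl empty))).partner 2 = 3 ∨
      (cup j hj (cup k hk (cup l hl empty))).partner 4 = 5 ∨
      ∀ p < 6, (cup j hj (cup k hk (cup l hl empty))).partner p = triangle.partner p := by
    decide
  exact (h j k l _ _ _).imp_right (Or.imp_right (Or.imp_right ext_of_lt))

set_option maxRecDepth 10000 in
theorem eight_cases (D : TLDiagram 8) :
    D.partner 0 = 1 ∨ D.partner 2 = 3 ∨ D.partner 4 = 5 ∨ D.partner 6 = 7 ∨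
      D = D₁ ∨ D = D₂ ∨ D = D₃ := by
  obtain ⟨j, D, rfl⟩ := exists_cup D
  obtain ⟨k, D, rfl⟩ := exists_cup D
  obtain ⟨l, D, rfl⟩ := exists_cup D
  obtain ⟨m, D, rfl⟩ := exists_cup D
  obtain rfl := eq_empty D
  -- Diagrams are compared only at the points below `8`, which keeps the statement decidable;
  -- `ext_of_lt` restores equality.
  have h : ∀ (j : Fin 7) (k : Fin 5) (l : Fin 3) (m : Fin 1) (hj : (j : ℕ) ≤ 6)
      (hk : (k : ℕ) ≤ 4) (hl : (l : ℕ) ≤ 2) (hm : (m : ℕ) ≤ 0),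
      (cup j hj (cup k hk (cup l hl (cup m hm empty)))).partner 0 = 1 ∨
      (cup j hj (cup k hk (cup l hl (cup m hm empty)))).partner 2 = 3 ∨
      (cup j hj (cup k hk (cup l hl (cup m hm empty)))).partner 4 = 5 ∨
      (cup j hj (cup k hk (cup l hl (cup m hm empty)))).partner 6 = 7 ∨
      (∀ p < 8, (cup j hj (cup k hk (cup l hl (cup m hm empty)))).partner p = D₁.partner p) ∨
      (∀ p < 8, (cup j hj (cup k hk (cup l hl (cup m hm empty)))).partner p = D₂.partner p) ∨
      ∀ p < 8, (cup j hj (cup k hk (cup l hl (cup m hm empty)))).partner p = D₃.partner p := by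
    decide +kernel
  exact (h j k l m _ _ _ _).imp_right (Or.imp_right (Or.imp_right (Or.imp_right
    (Or.imp ext_of_lt (Or.imp ext_of_lt ext_of_lt)))))

end TLDiagram

noncomputable section

namespace Fib

open TLDiagram

/-! ### The trace form on the quotient -/

theorem formQ_symm {N : ℕ} (x y : TLJSpace N) : star (formQ N x y) = formQ N y x := by
  obtain ⟨x, rfl⟩ := Submodule.Quotient.mk_surjective _ x
  obtain ⟨y, rfl⟩ := Submodule.Quotient.mk_surjective _ y
  exact form_symm x y

theorem formQ_tljU {N : ℕ} (j : ℕ) (x y : TLJSpace (N + 2)) :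
    formQ _ (tljU j x) y = formQ _ x (tljU j y) := by
  obtain ⟨x, rfl⟩ := Submodule.Quotient.mk_surjective _ x
  obtain ⟨y, rfl⟩ := Submodule.Quotient.mk_surjective _ y
  exact form_tlU j x y

/-- The class of a diagram in the Temperley-Lieb-Jones category. -/
def cls {N : ℕ} (D : TLDiagram N) : TLJSpace N := (nullSpace N).mkQ (.single D 1)

theorem tljU_cls {N j : ℕ} (hj : j ≤ N) (D : TLDiagram (N + 2)) :
    tljU j (cls D) = (if D.partner j = j + 1 then loopValue else 1) • cls (hook j hj D) := by
  have h : tljU j (cls D) = (nullSpace _).mkQ (tlU j (.single D 1)) := rfl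
  rw [h, tlU_single hj, cls, ← map_smul, Finsupp.smul_single, smul_eq_mul, mul_one, one_mul]
  rfl

theorem formQ_cls {N : ℕ} (D D' : TLDiagram N) :
    formQ N (cls D) (cls D') = loopValue ^ loops D D' := by
  rw [cls, cls, formQ_mk, form_single]
  simp

theorem span_cls (N : ℕ) : Submodule.span ℂ (Set.range (cls (N := N))) = ⊤ := by
  refine top_le_iff.1 fun q _ => ?_
  obtain ⟨x, rfl⟩ := Submodule.mkQ_surjective _ q
  induction x using Finsupp.induction_linear with
  | zero => simp
  | add x y hx hy => rw [map_add]; exact add_mem (hx trivial) (hy trivial)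
  | single D a =>
    have : (nullSpace N).mkQ (.single D a) = a • cls D := by
      rw [cls, ← map_smul, Finsupp.smul_single, smul_eq_mul, mul_one]
    rw [this]
    exact Submodule.smul_mem _ _ (Submodule.subset_span ⟨D, rfl⟩)

theorem jonesWenzl_tljU_mkQ {N s a : ℕ} (x : TLSpace (N + 2)) :
    jonesWenzl tljU s a ((nullSpace _).mkQ x) = (nullSpace _).mkQ (jonesWenzl tlU s a x) := by
  induction a using Nat.strong_induction_on generalizing x with
  | _ a ih =>
    match a with
    | 0 => rfl
    | 1 => rfl
    | a + 2 =>
      have h := fun x => ih (a + 1) (by omega) x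
      have hu : ∀ x, tljU (s + a) ((nullSpace (N + 2)).mkQ x) = (nullSpace _).mkQ (tlU (s + a) x) :=
        fun _ => rfl
      simp only [jonesWenzl, LinearMap.sub_apply, LinearMap.smul_apply, Module.End.mul_apply,
        map_sub, map_smul, h, hu]

/-- The relation `p_4 = 0`. -/
theorem jonesWenzl_four_eq_zero {N s : ℕ} (hs : s + 4 ≤ N + 2) :
    (jonesWenzl tljU s 4 : Module.End ℂ (TLJSpace (N + 2))) = 0 := by
  refine LinearMap.ext fun q => ?_
  obtain ⟨x, rfl⟩ := Submodule.mkQ_surjective _ q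
  rw [jonesWenzl_tljU_mkQ]
  exact (Submodule.Quotient.mk_eq_zero _).2 (IsNull.proj s hs x)

theorem formQ_jonesWenzl_two {N : ℕ} (j : ℕ) (x y : TLJSpace (N + 2)) :
    formQ _ (jonesWenzl tljU j 2 x) y = formQ _ x (jonesWenzl tljU j 2 y) := by
  simp only [jonesWenzl_two, LinearMap.sub_apply, LinearMap.smul_apply, Module.End.one_apply,
    map_sub, map_smulₛₗ, formQ_tljU, RingHom.id_apply, map_inv₀, starRingEnd_apply, star_loopValue]

/-! ### Unitarity -/

/-- As `u` is self-adjoint and `Ā = A⁻¹`, the adjoint of `A + A⁻¹ u` is its inverse `A⁻¹ + A u`. -/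
theorem formQ_crossing {N j : ℕ} (x y : TLJSpace (N + 2)) :
    formQ _ ((crossing j : (Module.End ℂ (TLJSpace (N + 2)))ˣ).val x)
      ((crossing j : (Module.End ℂ (TLJSpace (N + 2)))ˣ).val y) = formQ _ x y := by
  have hA := kauffmanA_ne_zero
  have h : tljU j (tljU j y) = loopValue • tljU j y := LinearMap.congr_fun (tljU_mul_self j) y
  simp only [crossing, LinearMap.add_apply, LinearMap.smul_apply, Module.End.one_apply,
    map_add, map_smulₛₗ, formQ_tljU, h, RingHom.id_apply, map_inv₀, starRingEnd_apply,
    star_kauffmanA, inv_inv, loopValue, smul_eq_mul]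
  field_simp
  ring

theorem formQ_cabledRep {m : ℕ} (β : BraidGroup 3) (x y : TLJSpace (m + 6)) :
    formQ _ ((cabledRep m β).val x) ((cabledRep m β).val y) = formQ _ x y := by
  let H : Subgroup (Module.End ℂ (TLJSpace (m + 4 + 2)))ˣ :=
    { carrier := {g | ∀ x y, formQ _ (g.val x) (g.val y) = formQ _ x y}
      one_mem' := fun x y => rfl
      mul_mem' := fun {g h} hg hh x y => by
        rw [Units.val_mul, Module.End.mul_apply, Module.End.mul_apply, hg, hh]
      inv_mem' := fun {g} hg x y => by
        rw [← hg, ← Module.End.mul_apply, ← Module.End.mul_apply, Units.mul_inv]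
        rfl }
  have hc : ∀ j, crossing j ∈ H := fun j => formQ_crossing
  have hβ : β ∈ Subgroup.comap (cabledRep m) H := by
    have h : β ∈ Subgroup.closure (Set.range (PresentedGroup.of (rels := braidRels 3))) := by
      rw [PresentedGroup.closure_range_of]
      trivial
    refine (Subgroup.closure_le _).2 ?_ h
    rintro _ ⟨k, rfl⟩
    rw [SetLike.mem_coe, Subgroup.mem_comap, cabledRep, PresentedGroup.toGroup.of]
    exact mul_mem (mul_mem (mul_mem (hc _) (hc _)) (hc _)) (hc _)
  exact hβ x y

/-! ### The projection onto the coloured morphisms -/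

section Colour

variable (i : Charge)

theorem commute_jonesWenzl_two {N s t : ℕ} (h : s + 2 ≤ t) :
    Commute (jonesWenzl tljU s 2 : Module.End ℂ (TLJSpace (N + 2))) (jonesWenzl tljU t 2) :=
  semiconj_jonesWenzl (X := jonesWenzl tljU s 2)
    (semiconj_jonesWenzl (X := tljU t) (tljU_comm h).symm).symm

/-- `Q` is the projector at the point coloured `i`: the identity for the label `1`, and `p_2` for
`τ`. Its listed properties let both labels be treated together. -/
theorem colour_factors : ∃ Q : Module.End ℂ (TLJSpace (i.label + 4 + 2)),
    colour i = jonesWenzl tljU 0 2 * jonesWenzl tljU 2 2 * jonesWenzl tljU 4 2 * Q ∧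
    (∀ s, s ≤ 4 → Commute (jonesWenzl tljU s 2) Q) ∧ (∀ s, s ≤ 4 → Commute (tljU s) Q) ∧
    Q * Q = Q ∧ (∀ x y, formQ _ (Q x) y = formQ _ x (Q y)) ∧ (i = .tau → Q * tljU 6 = 0) := by
  refine ⟨jonesWenzl tljU 6 i.label, rfl, ?_⟩
  cases i
  · refine ⟨fun _ _ => Commute.one_right _, fun _ _ => Commute.one_right _, mul_one _,
      fun x y => rfl, fun h => nomatch h⟩
  · exact ⟨fun s hs => commute_jonesWenzl_two (by omega), fun s hs =>
      semiconj_jonesWenzl (X := tljU s) (tljU_comm (by omega)), jonesWenzl_two_sq (tljU_mul_self 6),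
      formQ_jonesWenzl_two 6, fun _ => jonesWenzl_two_mul (tljU_mul_self 6)⟩

theorem colour_mul_self : colour i * colour i = colour i := by
  obtain ⟨Q, hQ, hc, -, hi, -, -⟩ := colour_factors i
  have c02 : Commute _ _ := commute_jonesWenzl_two (N := i.label + 4) (s := 0) (t := 2) le_rfl
  have c04 : Commute _ _ := commute_jonesWenzl_two (N := i.label + 4) (s := 0) (t := 4) (by simp)
  have c24 : Commute _ _ := commute_jonesWenzl_two (N := i.label + 4) (s := 2) (t := 4) le_rfl
  have I : ∀ s, IsIdempotentElem
      (jonesWenzl tljU s 2 : Module.End ℂ (TLJSpace (i.label + 4 + 2))) := fun s =>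
    jonesWenzl_two_sq (tljU_mul_self s)
  rw [hQ]
  exact ((((I 0).mul_of_commute c02 (I 2)).mul_of_commute (c04.mul_left c24) (I 4)).mul_of_commute
    (((hc 0 (by simp)).mul_left (hc 2 (by simp))).mul_left (hc 4 (by simp))) hi)

theorem formQ_colour (x y : TLJSpace (i.label + 6)) :
    formQ _ (colour i x) y = formQ _ x (colour i y) := by
  obtain ⟨Q, hQ, hc, -, -, hs, -⟩ := colour_factors i
  have c02 : Commute _ _ := commute_jonesWenzl_two (N := i.label + 4) (s := 0) (t := 2) le_rfl
  have c04 : Commute _ _ := commute_jonesWenzl_two (N := i.label + 4) (s := 0) (t := 4) (by simp)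
  have c24 : Commute _ _ := commute_jonesWenzl_two (N := i.label + 4) (s := 2) (t := 4) le_rfl
  have e : jonesWenzl tljU 0 2 * jonesWenzl tljU 2 2 * jonesWenzl tljU 4 2 * Q =
      Q * (jonesWenzl tljU 4 2 * (jonesWenzl tljU 2 2 * jonesWenzl tljU 0 2)) := by
    rw [← c02.eq, ← (c04.mul_left c24).eq]
    exact ((hc 0 (by simp)).mul_left (hc 2 (by simp))).mul_left (hc 4 (by simp))
  have e' : colour i y = Q (jonesWenzl tljU 4 2 (jonesWenzl tljU 2 2 (jonesWenzl tljU 0 2 y))) := by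
    rw [hQ, e]
    rfl
  rw [e', hQ]
  change formQ (i.label + 4 + 2) (jonesWenzl tljU 0 2 (jonesWenzl tljU 2 2
    (jonesWenzl tljU 4 2 (Q x)))) y = _
  rw [formQ_jonesWenzl_two, formQ_jonesWenzl_two, formQ_jonesWenzl_two, hs]

theorem colour_tljU {s : ℕ} (h : s = 0 ∨ s = 2 ∨ s = 4 ∨ s = 6 ∧ i = .tau)
    (x : TLJSpace (i.label + 4 + 2)) : colour i (tljU s x) = 0 := by
  obtain ⟨Q, hQ, -, hc, -, -, h6⟩ := colour_factors i
  have c : ∀ s t, s + 2 ≤ t ∨ t + 2 ≤ s → Commute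
      (jonesWenzl tljU s 2 : Module.End ℂ (TLJSpace (i.label + 4 + 2))) (tljU t) := fun s t h =>
    (semiconj_jonesWenzl (X := tljU t)
      (h.elim (fun h => (tljU_comm h).symm) fun h => tljU_comm h)).symm
  have z : ∀ s, (jonesWenzl tljU s 2 : Module.End ℂ (TLJSpace (i.label + 4 + 2))) * tljU s = 0 :=
    fun s => jonesWenzl_two_mul (tljU_mul_self s)
  suffices h : colour i * tljU s = 0 from LinearMap.congr_fun h x
  rw [hQ]
  rcases h with rfl | rfl | rfl | ⟨rfl, h⟩
  · rw [mul_assoc, ← (hc 0 (by simp)).eq, ← mul_assoc, mul_assoc _ _ (tljU 0),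
      (c 4 0 (by simp)).eq, ← mul_assoc, mul_assoc _ _ (tljU 0), (c 2 0 (by simp)).eq,
      ← mul_assoc, z]
    simp
  · rw [mul_assoc, ← (hc 2 (by simp)).eq, ← mul_assoc, mul_assoc _ _ (tljU 2),
      (c 4 2 (by simp)).eq, ← mul_assoc, mul_assoc _ _ (tljU 2), z]
    simp
  · rw [mul_assoc, ← (hc 4 (by simp)).eq, ← mul_assoc, mul_assoc _ _ (tljU 4), z]
    simp
  · rw [mul_assoc, h6 h, mul_zero]

/-- A diagram with the arc `s, s + 1` is `d⁻¹ u_s` applied to itself, and `p_2 u_s = 0`. -/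
theorem colour_cls_eq_zero {s : ℕ} (h : s = 0 ∨ s = 2 ∨ s = 4 ∨ s = 6 ∧ i = .tau)
    {D : TLDiagram (i.label + 4 + 2)} (hD : D.partner s = s + 1) :
    colour i (cls D) = 0 := by
  have hs : s ≤ i.label + 4 := by
    rcases h with rfl | rfl | rfl | ⟨rfl, rfl⟩ <;> simp [Charge.label]
  have h1 : cls D = loopValue⁻¹ • tljU s (cls D) := by
    rw [tljU_cls hs, if_pos hD, hook, hook_of_eq hs D hD, inv_smul_smul₀ loopValue_ne_zero]
  rw [h1, map_smul, colour_tljU i h, smul_zero]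

end Colour

/-- The inner product on the coloured morphisms. -/
def traceInner (i : Charge) : V i →ₗ⋆[ℂ] V i →ₗ[ℂ] ℂ :=
  (formQ (i.label + 6)).domRestrict₁₂ (V i) (V i)

end Fib

end

noncomputable section

namespace Fib

open TLDiagram

/-! ### Explicit computation: braid generators and Gram matrices -/

theorem kauffmanA_inv : kauffmanA⁻¹ = -kauffmanA ^ 4 := by
  refine inv_eq_of_mul_eq_one_right ?_
  linear_combination -kauffmanA_pow_five

theorem loopValue_eq_kauffmanA : loopValue = kauffmanA ^ 3 - kauffmanA ^ 2 := by
  rw [loopValue, kauffmanA_inv]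
  linear_combination -kauffmanA ^ 3 * kauffmanA_pow_five

/-- `A` is a primitive tenth root of unity, and this is its cyclotomic equation. It reduces all
scalars below to polynomials in `A` of degree at most three. -/
theorem kauffmanA_pow_four :
    kauffmanA ^ 4 = kauffmanA ^ 3 - kauffmanA ^ 2 + kauffmanA - 1 := by
  have h := loopValue_sq
  rw [loopValue_eq_kauffmanA] at h
  linear_combination h - (kauffmanA - 2) * kauffmanA_pow_five

theorem crossing_apply {N : ℕ} (j : ℕ) (x : TLJSpace (N + 2)) :
    (crossing j : (Module.End ℂ (TLJSpace (N + 2)))ˣ).val x =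
      kauffmanA • x + kauffmanA⁻¹ • tljU j x := rfl

/-- The projection onto `Hom(τ, τ ⊗ τ ⊗ τ)`. -/
def tauProj : Module.End ℂ (TLJSpace (6 + 2)) := colour .tau

def E₁ : TLJSpace (6 + 2) := tauProj (cls D₁)

def E₂ : TLJSpace (6 + 2) := tauProj (cls D₂)

def E₃ : TLJSpace (6 + 2) := tauProj (cls D₃)

/-- The case distinction uses only decidable tests on partners, so that `simp +decide` can project
every diagram of an expansion. -/
theorem tauProj_cls (D : TLDiagram (6 + 2)) : tauProj (cls D) =
    if D.partner 0 = 1 ∨ D.partner 2 = 3 ∨ D.partner 4 = 5 ∨ D.partner 6 = 7 then 0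
    else if D.partner 0 = 3 then E₁ else if D.partner 1 = 6 then E₂ else E₃ := by
  rcases eight_cases D with h | h | h | h | rfl | rfl | rfl
  · rw [if_pos (.inl h)]
    exact colour_cls_eq_zero .tau (s := 0) (by simp) h
  · rw [if_pos (.inr (.inl h))]
    exact colour_cls_eq_zero .tau (s := 2) (by simp) h
  · rw [if_pos (.inr (.inr (.inl h)))]
    exact colour_cls_eq_zero .tau (s := 4) (by simp) h
  · rw [if_pos (.inr (.inr (.inr h)))]
    exact colour_cls_eq_zero .tau (s := 6) (by simp) h
  · rw [if_neg (by decide), if_pos (by decide), E₁]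
  · rw [if_neg (by decide), if_neg (by decide), if_pos (by decide), E₂]
  · rw [if_neg (by decide), if_neg (by decide), if_neg (by decide), E₃]

set_option maxRecDepth 100000 in
-- `D₁` joins the points `2, ..., 5` to the other four, so `p_4` applied there is the expansion of
-- `p_4` itself. After the colouring only multiples of `E₁`, `E₂`, `E₃` remain, and this is the
-- relation between them.
theorem E₃_eq : E₃ = (2 - loopValue) • (E₁ + E₂) := by
  have h : tauProj (jonesWenzl tljU 2 4 (cls D₁)) = 0 := by
    rw [jonesWenzl_four_eq_zero (by simp)]
    simp
  simp +decide only [jonesWenzl_four, jonesWenzl_three, jonesWenzl_two, Module.End.mul_apply,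
    LinearMap.sub_apply, LinearMap.smul_apply, Module.End.one_apply, map_sub, map_smul, tljU_cls,
    tauProj_cls, if_true, if_false] at h
  linear_combination (norm := (match_scalars <;> grind [loopValue_sq, loopValue_inv]))
    (loopValue - 2) • h

set_option maxRecDepth 100000 in
-- In `D₁` the two crossed points are joined to each other, so `E₁` is an eigenvector; the doubled
-- curl contributes `A⁻⁸ = A²`.
theorem tauProj_cabledCrossing_zero_E₁ :
    tauProj ((cabledCrossing 0 : (Module.End ℂ (TLJSpace (6 + 2)))ˣ).val (cls D₁)) =
      kauffmanA ^ 2 • E₁ := by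
  simp +decide only [cabledCrossing, Units.val_mul, Module.End.mul_apply, crossing_apply, map_add,
    map_smul, tljU_cls, tauProj_cls, if_true, if_false]
  match_scalars
  all_goals
    simp only [kauffmanA_inv, loopValue_eq_kauffmanA]
    grind [kauffmanA_pow_four]

set_option maxRecDepth 100000 in
theorem tauProj_cabledCrossing_zero_E₂ :
    tauProj ((cabledCrossing 0 : (Module.End ℂ (TLJSpace (6 + 2)))ˣ).val (cls D₂)) =
      kauffmanA • E₂ - kauffmanA ^ 4 • E₁ := by
  simp +decide only [cabledCrossing, Units.val_mul, Module.End.mul_apply, crossing_apply, map_add,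
    map_smul, tljU_cls, tauProj_cls, if_true, if_false, E₃_eq]
  match_scalars
  all_goals
    simp only [kauffmanA_inv, loopValue_eq_kauffmanA]
    grind [kauffmanA_pow_four]

set_option maxRecDepth 100000 in
theorem tauProj_cabledCrossing_one_E₁ :
    tauProj ((cabledCrossing 1 : (Module.End ℂ (TLJSpace (6 + 2)))ˣ).val (cls D₁)) =
      kauffmanA • E₁ - kauffmanA ^ 4 • E₂ := by
  simp +decide only [cabledCrossing, Units.val_mul, Module.End.mul_apply, crossing_apply, map_add,
    map_smul, tljU_cls, tauProj_cls, if_true, if_false, E₃_eq]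
  match_scalars
  all_goals
    simp only [kauffmanA_inv, loopValue_eq_kauffmanA]
    grind [kauffmanA_pow_four]

set_option maxRecDepth 100000 in
theorem tauProj_cabledCrossing_one_E₂ :
    tauProj ((cabledCrossing 1 : (Module.End ℂ (TLJSpace (6 + 2)))ˣ).val (cls D₂)) =
      kauffmanA ^ 2 • E₂ := by
  simp +decide only [cabledCrossing, Units.val_mul, Module.End.mul_apply, crossing_apply, map_add,
    map_smul, tljU_cls, tauProj_cls, if_true, if_false]
  match_scalars
  all_goals
    simp only [kauffmanA_inv, loopValue_eq_kauffmanA]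
    grind [kauffmanA_pow_four]

theorem tauProj_tauProj (x : TLJSpace (6 + 2)) : tauProj (tauProj x) = tauProj x :=
  LinearMap.congr_fun (colour_mul_self .tau) x

/-- An orthogonal projection is needed on one side only, so a Gram entry requires the expansion of a
single projector. -/
theorem formQ_tauProj (x y : TLJSpace (6 + 2)) :
    formQ _ (tauProj x) (tauProj y) = formQ _ x (tauProj y) := by
  conv_rhs => rw [← tauProj_tauProj]
  exact formQ_colour .tau _ _

theorem tauProj_apply (x : TLJSpace (6 + 2)) : tauProj x =
    jonesWenzl tljU 0 2 (jonesWenzl tljU 2 2 (jonesWenzl tljU 4 2 (jonesWenzl tljU 6 2 x))) := rfl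

set_option maxRecDepth 100000 in
theorem formQ_E₁_E₁ : formQ _ E₁ E₁ = loopValue ^ 2 := by
  rw [E₁, formQ_tauProj]
  simp +decide only [tauProj_apply, jonesWenzl_two, LinearMap.sub_apply, LinearMap.smul_apply,
    Module.End.one_apply, map_sub, map_smul, tljU_cls, formQ_cls, if_true, if_false, smul_eq_mul]
  simp +decide only [D₁, loops_cup, loops_zero, if_true, if_false]
  grind [loopValue_sq, loopValue_inv]

set_option maxRecDepth 100000 in
theorem formQ_E₂_E₂ : formQ _ E₂ E₂ = loopValue ^ 2 := by
  rw [E₂, formQ_tauProj]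
  simp +decide only [tauProj_apply, jonesWenzl_two, LinearMap.sub_apply, LinearMap.smul_apply,
    Module.End.one_apply, map_sub, map_smul, tljU_cls, formQ_cls, if_true, if_false, smul_eq_mul]
  simp +decide only [D₂, loops_cup, loops_zero, if_true, if_false]
  grind [loopValue_sq, loopValue_inv]

set_option maxRecDepth 100000 in
theorem formQ_E₁_E₂ : formQ _ E₁ E₂ = loopValue := by
  rw [E₁, E₂, formQ_tauProj]
  simp +decide only [tauProj_apply, jonesWenzl_two, LinearMap.sub_apply, LinearMap.smul_apply,
    Module.End.one_apply, map_sub, map_smul, tljU_cls, formQ_cls, if_true, if_false, smul_eq_mul]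
  simp +decide only [D₁, D₂, loops_cup, loops_zero, if_true, if_false]
  grind [loopValue_sq, loopValue_inv]

/-- The projection onto `Hom(1, τ ⊗ τ ⊗ τ)`. -/
def oneProj : Module.End ℂ (TLJSpace (4 + 2)) := colour .one

def E₀ : TLJSpace (4 + 2) := oneProj (cls triangle)

theorem oneProj_cls (D : TLDiagram (4 + 2)) : oneProj (cls D) =
    if D.partner 0 = 1 ∨ D.partner 2 = 3 ∨ D.partner 4 = 5 then 0 else E₀ := by
  rcases six_cases D with h | h | h | rfl
  · rw [if_pos (.inl h)]
    exact colour_cls_eq_zero .one (s := 0) (by simp) h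
  · rw [if_pos (.inr (.inl h))]
    exact colour_cls_eq_zero .one (s := 2) (by simp) h
  · rw [if_pos (.inr (.inr h))]
    exact colour_cls_eq_zero .one (s := 4) (by simp) h
  · rw [if_neg (by decide), E₀]

theorem oneProj_apply (x : TLJSpace (4 + 2)) : oneProj x =
    jonesWenzl tljU 0 2 (jonesWenzl tljU 2 2 (jonesWenzl tljU 4 2 x)) := rfl

set_option maxRecDepth 100000 in
theorem formQ_E₀_E₀ : formQ _ E₀ E₀ = loopValue⁻¹ := by
  have h : formQ _ E₀ E₀ = formQ _ (cls triangle) (oneProj (oneProj (cls triangle))) :=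
    formQ_colour .one _ _
  have h' : oneProj (oneProj (cls triangle)) = oneProj (cls triangle) :=
    LinearMap.congr_fun (colour_mul_self .one) _
  rw [h, h']
  simp +decide only [oneProj_apply, jonesWenzl_two, LinearMap.sub_apply, LinearMap.smul_apply,
    Module.End.one_apply, map_sub, map_smul, tljU_cls, formQ_cls, if_true, if_false, smul_eq_mul]
  simp +decide only [triangle, loops_cup, loops_zero, if_true, if_false]
  grind [loopValue_sq, loopValue_inv]

end Fib

end

noncomputable section

namespace Fib

/-! ### Orthonormal bases, and the passage from operators to matrices -/

section Orthonormal

variable {n : ℕ} {W : Type*} [AddCommGroup W] [Module ℂ W] {ip : W →ₗ⋆[ℂ] W →ₗ[ℂ] ℂ}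

/-- An orthonormal spanning family is a basis. -/
theorem exists_basis_of_orthonormal {f : Fin n → W}
    (hf : ∀ i j, ip (f i) (f j) = if i = j then 1 else 0)
    (hs : ⊤ ≤ Submodule.span ℂ (Set.range f)) : ∃ b : Module.Basis (Fin n) ℂ W, ⇑b = f := by
  have hi : LinearIndependent ℂ f := by
    rw [Fintype.linearIndependent_iff]
    intro g hg i
    have := congrArg (ip (f i)) hg
    simpa [map_sum, hf] using this
  exact ⟨Module.Basis.mk hi hs, Module.Basis.coe_mk hi hs⟩

variable {b : Module.Basis (Fin n) ℂ W} (hb : ∀ i j, ip (b i) (b j) = if i = j then 1 else 0)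

include hb

theorem inner_eq_dotProduct (v w : W) : ip v w = star ⇑(b.repr v) ⬝ᵥ ⇑(b.repr w) := by
  conv_lhs => rw [← b.sum_repr v, ← b.sum_repr w]
  simp only [map_sum, map_smulₛₗ, LinearMap.sum_apply, LinearMap.smul_apply, hb, dotProduct,
    smul_eq_mul, RingHom.id_apply, mul_ite, mul_one, mul_zero, Finset.mem_univ,
    if_true, starRingEnd_apply, Finset.sum_ite_eq', Pi.star_apply]
  exact Finset.sum_congr rfl fun _ _ => mul_comm _ _

theorem inner_hermitian (v w : W) : star (ip w v) = ip v w := by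
  rw [inner_eq_dotProduct hb, inner_eq_dotProduct hb, Matrix.star_dotProduct, star_star]

open ComplexOrder in
theorem inner_pos {v : W} (hv : v ≠ 0) : 0 < (ip v v).re := by
  rw [inner_eq_dotProduct hb]
  have h : (b.repr v : Fin n → ℂ) ≠ 0 := by
    intro h
    exact hv (b.repr.map_eq_zero_iff.1 (DFunLike.coe_injective h))
  exact (Complex.pos_iff.1 (Matrix.dotProduct_star_self_pos_iff.2 h)).1

theorem inner_map_eq_iff (g : Module.End ℂ W) :
    (∀ v w, ip (g v) (g w) = ip v w) ↔
      LinearMap.toMatrix b b g ∈ Matrix.unitaryGroup (Fin n) ℂ := by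
  have key : ∀ v w, ip (g v) (g w) = star ⇑(b.repr v) ⬝ᵥ
      ((star (LinearMap.toMatrix b b g) * LinearMap.toMatrix b b g).mulVec ⇑(b.repr w)) := by
    intro v w
    rw [inner_eq_dotProduct hb, ← LinearMap.toMatrix_mulVec_repr b b g v,
      ← LinearMap.toMatrix_mulVec_repr b b g w, Matrix.star_mulVec, ← Matrix.mulVec_mulVec,
      Matrix.dotProduct_mulVec _ (star _), Matrix.star_eq_conjTranspose]
  rw [Matrix.mem_unitaryGroup_iff']
  constructor
  · intro h
    ext i j
    have := (key (b i) (b j)).symm.trans (h _ _)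
    rw [hb] at this
    simpa only [b.repr_self, Finsupp.single_eq_pi_single, Matrix.one_apply, ← Pi.single_star,
      star_one, Matrix.mulVec_single_one, single_one_dotProduct, Matrix.col_apply] using this
  · intro h v w
    rw [key, h, Matrix.one_mulVec, inner_eq_dotProduct hb]

theorem mem_specialUnitary_iff (g : Module.End ℂ W) :
    g ∈ specialUnitary ip ↔ LinearMap.toMatrix b b g ∈ Matrix.specialUnitaryGroup (Fin n) ℂ := by
  rw [Matrix.mem_specialUnitaryGroup_iff, ← inner_map_eq_iff hb, LinearMap.det_toMatrix]
  rfl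

end Orthonormal

instance (i : Charge) : IsModuleTopology ℂ (Module.End ℂ (V i)) := ⟨rfl⟩

theorem continuous_toLin {n : ℕ} (i : Charge) (b : Module.Basis (Fin n) ℂ (V i)) :
    Continuous (Matrix.toLin b b) := by
  have : ContinuousAdd (Module.End ℂ (V i)) := IsModuleTopology.toContinuousAdd ℂ _
  have : ContinuousSMul ℂ (Module.End ℂ (V i)) := IsModuleTopology.toContinuousSMul ℂ _
  have : IsModuleTopology ℂ (Matrix (Fin n) (Fin n) ℂ) :=
    inferInstanceAs (IsModuleTopology ℂ (Fin n → Fin n → ℂ))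
  exact IsModuleTopology.continuous_of_linearMap _

/-- The matrices of the braids. -/
def matrixRep {n : ℕ} (i : Charge) (b : Module.Basis (Fin n) ℂ (V i)) :
    BraidGroup 3 →* Matrix (Fin n) (Fin n) ℂ :=
  (LinearMap.toMatrixAlgEquiv b : Module.End ℂ (V i) →* Matrix (Fin n) (Fin n) ℂ).comp (rho i)

/-- The map from matrices to operators is linear, hence continuous for the module topology, so it
carries closures into closures. -/
theorem specialUnitary_subset_closure {n : ℕ} {i : Charge} {ip : V i →ₗ⋆[ℂ] V i →ₗ[ℂ] ℂ}
    {b : Module.Basis (Fin n) ℂ (V i)} (hb : ∀ j k, ip (b j) (b k) = if j = k then 1 else 0)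
    (h : ∀ M ∈ Matrix.specialUnitaryGroup (Fin n) ℂ, M ∈ closure (Set.range (matrixRep i b))) :
    specialUnitary ip ⊆ closure (Set.range (rho i)) := by
  intro g hg
  have h1 := h _ ((mem_specialUnitary_iff hb g).1 hg)
  have h2 := image_closure_subset_closure_image (continuous_toLin i b) (Set.mem_image_of_mem _ h1)
  rw [Matrix.toLin_toMatrix] at h2
  refine closure_mono ?_ h2
  rintro _ ⟨_, ⟨β, rfl⟩, rfl⟩
  exact ⟨β, (Matrix.toLin_toMatrix b b (rho i β)).symm⟩

theorem traceInner_trace_form (i : Charge) (x y : TLSpace (i.label + 6))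
    (hx : (nullSpace _).mkQ x ∈ V i) (hy : (nullSpace _).mkQ y ∈ V i) :
    traceInner i ⟨(nullSpace _).mkQ x, hx⟩ ⟨(nullSpace _).mkQ y, hy⟩ = markovInner x y := rfl

theorem rho_apply (i : Charge) (β : BraidGroup 3) (v : V i) :
    (rho i β v : TLJSpace (i.label + 6)) = (cabledRep i.label β).val v.1 := rfl

theorem traceInner_rho (i : Charge) (β : BraidGroup 3) (v w : V i) :
    traceInner i (rho i β v) (rho i β w) = traceInner i v w :=
  formQ_cabledRep β v.1 w.1

/-- The space of coloured morphisms is spanned by the coloured diagrams. -/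
theorem V_le_span (i : Charge) (S : Submodule ℂ (TLJSpace (i.label + 6)))
    (h : ∀ D : TLDiagram (i.label + 6), colour i (cls D) ∈ S) : V i ≤ S := by
  rw [V, LinearMap.range_eq_map, ← span_cls, Submodule.map_span, Submodule.span_le]
  rintro _ ⟨_, ⟨D, rfl⟩, rfl⟩
  exact h D

theorem top_le_span_of_forall {n : ℕ} {i : Charge} (f : Fin n → V i)
    (h : ∀ D : TLDiagram (i.label + 6),
      colour i (cls D) ∈ Submodule.span ℂ (Set.range fun k => (f k : TLJSpace (i.label + 6)))) :
    ⊤ ≤ Submodule.span ℂ (Set.range f) := by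
  have h1 := V_le_span i _ h
  intro v _
  have h2 := h1 v.2
  rw [show (Set.range fun k => (f k : TLJSpace (i.label + 6))) = (V i).subtype '' Set.range f by
    rw [← Set.range_comp]; rfl, ← Submodule.map_span] at h2
  obtain ⟨w, hw, e⟩ := h2
  rwa [← Subtype.ext e]

/-- The square root of the loop value. -/
def sqrtLoop : ℂ := ((Real.sqrt Real.goldenRatio : ℝ) : ℂ)

theorem sqrtLoop_sq : sqrtLoop ^ 2 = loopValue := by
  rw [sqrtLoop, loopValue_eq, ← Complex.ofReal_pow, Real.sq_sqrt Real.goldenRatio_pos.le]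

theorem star_sqrtLoop : star sqrtLoop = sqrtLoop := by
  rw [sqrtLoop, Complex.star_def, Complex.conj_ofReal]

theorem sqrtLoop_ne_zero : sqrtLoop ≠ 0 := by
  intro h
  apply loopValue_ne_zero
  rw [← sqrtLoop_sq, h]
  norm_num

theorem oneProj_cls_mem {S : Submodule ℂ (TLJSpace (4 + 2))} (h : E₀ ∈ S)
    (D : TLDiagram (4 + 2)) : oneProj (cls D) ∈ S := by
  rw [oneProj_cls]
  split_ifs
  · exact zero_mem _
  · exact h

theorem tauProj_cls_mem {S : Submodule ℂ (TLJSpace (6 + 2))} (h1 : E₁ ∈ S) (h2 : E₂ ∈ S)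
    (D : TLDiagram (6 + 2)) : tauProj (cls D) ∈ S := by
  rw [tauProj_cls]
  split_ifs
  · exact zero_mem _
  · exact h1
  · exact h2
  · rw [E₃_eq]
    exact Submodule.smul_mem _ _ (add_mem h1 h2)

theorem exists_orthonormal_one : ∃ b : Module.Basis (Fin 1) ℂ (V .one),
    ∀ j k, traceInner .one (b j) (b k) = if j = k then 1 else 0 := by
  let e : V .one := ⟨E₀, ⟨_, rfl⟩⟩
  have he : traceInner .one e e = loopValue⁻¹ := formQ_E₀_E₀
  -- The vector `e` has squared norm `d⁻¹`, so it is scaled by `√d`.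
  have h : ∀ j k : Fin 1, traceInner .one ((fun _ => sqrtLoop • e) j) ((fun _ => sqrtLoop • e) k) =
      if j = k then 1 else 0 := by
    intro j k
    rw [if_pos (Subsingleton.elim j k)]
    simp only [map_smulₛₗ, LinearMap.smul_apply, RingHom.id_apply, he, starRingEnd_apply,
      star_sqrtLoop, smul_eq_mul]
    rw [← mul_assoc, ← sq, sqrtLoop_sq, mul_inv_cancel₀ loopValue_ne_zero]
  obtain ⟨b, hb⟩ := exists_basis_of_orthonormal h (top_le_span_of_forall _ fun D => by
    have e0 : e.1 ∈ Submodule.span ℂ (Set.range fun _ : Fin 1 => (sqrtLoop • e : V .one).1) := by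
      have : e.1 = sqrtLoop⁻¹ • (sqrtLoop • e : V .one).1 :=
        (inv_smul_smul₀ sqrtLoop_ne_zero e.1).symm
      rw [this]
      exact Submodule.smul_mem _ _ (Submodule.subset_span ⟨0, rfl⟩)
    exact oneProj_cls_mem e0 D)
  exact ⟨b, by rw [hb]; exact h⟩

/-- The coloured diagrams `E₁`, `E₂` as vectors of `Hom(τ, τ ⊗ τ ⊗ τ)`. -/
def v₁ : V .tau := ⟨E₁, ⟨_, rfl⟩⟩

def v₂ : V .tau := ⟨E₂, ⟨_, rfl⟩⟩

theorem traceInner_v₁_v₁ : traceInner .tau v₁ v₁ = loopValue ^ 2 := formQ_E₁_E₁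

theorem traceInner_v₂_v₂ : traceInner .tau v₂ v₂ = loopValue ^ 2 := formQ_E₂_E₂

theorem traceInner_v₁_v₂ : traceInner .tau v₁ v₂ = loopValue := formQ_E₁_E₂

theorem traceInner_v₂_v₁ : traceInner .tau v₂ v₁ = loopValue := by
  have h : star (traceInner .tau v₁ v₂) = traceInner .tau v₂ v₁ := formQ_symm v₁.1 v₂.1
  rw [← h, traceInner_v₁_v₂, star_loopValue]

theorem span_v₁_v₂ : ⊤ ≤ Submodule.span ℂ (Set.range ![v₁, v₂]) := by
  refine top_le_span_of_forall _ fun D => ?_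
  have e1 : E₁ ∈ Submodule.span ℂ (Set.range fun k => (![v₁, v₂] k).1) :=
    Submodule.subset_span ⟨0, rfl⟩
  have e2 : E₂ ∈ Submodule.span ℂ (Set.range fun k => (![v₁, v₂] k).1) :=
    Submodule.subset_span ⟨1, rfl⟩
  exact tauProj_cls_mem e1 e2 D

theorem exists_orthonormal_tau : ∃ b : Module.Basis (Fin 2) ℂ (V .tau),
    ∀ j k, traceInner .tau (b j) (b k) = if j = k then 1 else 0 := by
  -- Gram–Schmidt: `v₁` has norm `d`, and the part of `v₂` orthogonal to `v₁` has squared norm `d² -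
  -- 1 = d`.
  let f : Fin 2 → V .tau := ![loopValue⁻¹ • v₁, sqrtLoop⁻¹ • (v₂ - loopValue⁻¹ • v₁)]
  have hd := loopValue_ne_zero
  have hs := sqrtLoop_ne_zero
  have hd' : loopValue - loopValue⁻¹ * loopValue ^ 2 = 0 := by
    rw [sq, inv_mul_cancel_left₀ hd, sub_self]
  have h : ∀ j k, traceInner .tau (f j) (f k) = if j = k then 1 else 0 := by
    intro j k
    fin_cases j <;> fin_cases k <;>
      simp [f, map_smulₛₗ, traceInner_v₁_v₁, traceInner_v₁_v₂, traceInner_v₂_v₁, traceInner_v₂_v₂,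
        star_loopValue, star_sqrtLoop, ← Complex.star_def, hd]
    · rw [sq, inv_mul_cancel_left₀ hd, inv_mul_cancel₀ hd]
    · exact Or.inr hd'
    · exact Or.inr hd'
    · rw [← mul_assoc, ← mul_inv, ← sq, sqrtLoop_sq]
      field_simp
      linear_combination loopValue_sq
  obtain ⟨b, hb⟩ := exists_basis_of_orthonormal h (by
    refine span_v₁_v₂.trans (Submodule.span_le.2 ?_)
    have e1 : v₁ ∈ Submodule.span ℂ (Set.range f) := by
      have : v₁ = loopValue • f 0 := by simp [f, hd]
      rw [this]
      exact Submodule.smul_mem _ _ (Submodule.subset_span ⟨0, rfl⟩)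
    have e2 : v₂ ∈ Submodule.span ℂ (Set.range f) := by
      have : v₂ = sqrtLoop • f 1 + loopValue⁻¹ • v₁ := by simp [f, hs]
      rw [this]
      exact add_mem (Submodule.smul_mem _ _ (Submodule.subset_span ⟨1, rfl⟩))
        (Submodule.smul_mem _ _ e1)
    rintro _ ⟨k, rfl⟩
    fin_cases k
    · exact e1
    · exact e2)
  exact ⟨b, by rw [hb]; exact h⟩

/-! ### The images of the generators -/

/-- The generators of the braid group. -/
def braidGen (k : Fin 2) : BraidGroup 3 := PresentedGroup.of (rels := braidRels 3) k

/-- Braids commute with the colouring, so a crossing may be applied to the uncoloured diagram and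
projected afterwards. -/
theorem rho_braidGen_tau (k : Fin 2) (x : TLJSpace (6 + 2)) (v : V .tau) (hv : v.1 = tauProj x) :
    (rho .tau (braidGen k) v).1 =
      tauProj ((cabledCrossing k : (Module.End ℂ (TLJSpace (6 + 2)))ˣ).val x) := by
  have h : (cabledRep 2 (braidGen k)).val =
      (cabledCrossing k : (Module.End ℂ (TLJSpace (6 + 2)))ˣ).val := by
    rw [braidGen, cabledRep, PresentedGroup.toGroup.of]
  have h2 := LinearMap.congr_fun (commute_cabledCrossing .tau k).eq x
  rw [rho_apply, hv]
  exact (LinearMap.congr_fun h _).trans h2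

theorem rho_zero_v₁ : rho .tau (braidGen 0) v₁ = kauffmanA ^ 2 • v₁ :=
  Subtype.ext ((rho_braidGen_tau 0 _ v₁ rfl).trans tauProj_cabledCrossing_zero_E₁)

theorem rho_zero_v₂ : rho .tau (braidGen 0) v₂ = kauffmanA • v₂ - kauffmanA ^ 4 • v₁ :=
  Subtype.ext ((rho_braidGen_tau 0 _ v₂ rfl).trans tauProj_cabledCrossing_zero_E₂)

theorem rho_one_v₁ : rho .tau (braidGen 1) v₁ = kauffmanA • v₁ - kauffmanA ^ 4 • v₂ :=
  Subtype.ext ((rho_braidGen_tau 1 _ v₁ rfl).trans tauProj_cabledCrossing_one_E₁)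

theorem rho_one_v₂ : rho .tau (braidGen 1) v₂ = kauffmanA ^ 2 • v₂ :=
  Subtype.ext ((rho_braidGen_tau 1 _ v₂ rfl).trans tauProj_cabledCrossing_one_E₂)

end Fib

end

noncomputable section

/-! ### Dense subgroups of `SU(2)` -/

namespace SU2

open Matrix Complex

/-- The matrix with rows `(a, b)` and `(-b̄, ā)`. -/
def mat (a b : ℂ) : Matrix (Fin 2) (Fin 2) ℂ := !![a, b; -star b, star a]

theorem mat_mul (a b c d : ℂ) : mat a b * mat c d = mat (a * c - b * star d) (a * d + b * star c) := by
  ext i j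
  fin_cases i <;> fin_cases j <;> simp [mat, Matrix.mul_apply, Fin.sum_univ_two] <;> ring

theorem mat_one : mat 1 0 = 1 := by
  ext i j
  fin_cases i <;> fin_cases j <;> simp [mat]

/-- For determinant one the inverse is the adjugate, and for a unitary matrix it is the adjoint;
comparing entries gives the form. -/
theorem eq_mat {M : Matrix (Fin 2) (Fin 2) ℂ} (h : M ∈ specialUnitaryGroup (Fin 2) ℂ) :
    M = mat (M 0 0) (M 0 1) ∧ normSq (M 0 0) + normSq (M 0 1) = 1 := by
  obtain ⟨h1, h2⟩ := mem_specialUnitaryGroup_iff.1 h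
  have h3 : star M = M.adjugate := by
    have := congrArg (fun X => X * M.adjugate) (mem_unitaryGroup_iff'.1 h1)
    simpa [Matrix.mul_assoc, Matrix.mul_adjugate, h2] using this
  rw [adjugate_fin_two] at h3
  have e00 := congrFun (congrFun h3 0) 0
  have e10 := congrFun (congrFun h3 1) 0
  simp only [star_apply, of_apply, cons_val', cons_val_zero, cons_val_one, cons_val_fin_one]
    at e00 e10
  have h10 : M 1 0 = -star (M 0 1) := by rw [e10, neg_neg]
  constructor
  · ext i j
    fin_cases i <;> fin_cases j
    · rfl
    · rfl
    · exact h10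
    · exact e00.symm
  · rw [det_fin_two, ← e00, h10] at h2
    apply ofReal_injective
    push_cast
    rw [normSq_eq_conj_mul_self, normSq_eq_conj_mul_self]
    simp only [starRingEnd_apply]
    linear_combination h2

/-- The powers of an element of infinite order are dense in the circle. -/
theorem denseRange_pow {z : Circle} (hz : ∀ n : ℕ, 0 < n → z ^ n ≠ 1) :
    DenseRange (z ^ · : ℕ → Circle) := by
  rw [← denseRange_zpow_iff_pow]
  have : Fact (0 < 2 * Real.pi) := ⟨Real.two_pi_pos⟩
  obtain ⟨a, rfl⟩ : ∃ a : AddCircle (2 * Real.pi), AddCircle.toCircle a = z :=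
    (AddCircle.homeomorphCircle Real.two_pi_pos.ne').surjective z |>.imp fun a h => by
      rwa [AddCircle.homeomorphCircle_apply] at h
  have h : DenseRange (· • a : ℤ → AddCircle (2 * Real.pi)) := by
    rw [AddCircle.denseRange_zsmul_iff, addOrderOf_eq_zero_iff']
    intro n hn h0
    apply hz n hn
    rw [← AddCircle.toCircle_nsmul, h0, AddCircle.toCircle_zero]
  have h2 := (AddCircle.homeomorphCircle Real.two_pi_pos.ne').surjective.denseRange.comp h
    (AddCircle.homeomorphCircle (T := 2 * Real.pi) Real.two_pi_pos.ne').continuous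
  convert h2 using 2 with n
  rw [Function.comp_apply, AddCircle.homeomorphCircle_apply, AddCircle.toCircle_zsmul]

variable {C : Submonoid (Matrix (Fin 2) (Fin 2) ℂ)}

/-- Positive powers of `z` are already dense in the circle, so a closed monoid suffices and no
inverses are needed. -/
theorem mat_torus_mem (hC : IsClosed (C : Set (Matrix (Fin 2) (Fin 2) ℂ))) {z : Circle}
    (hz : ∀ n : ℕ, 0 < n → z ^ n ≠ 1) (h : mat z 0 ∈ C) (w : Circle) : mat w 0 ∈ C := by
  have hc : Continuous fun w : Circle => mat w 0 := by
    unfold mat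
    fun_prop
  have hp : ∀ n : ℕ, mat ((z ^ n : Circle) : ℂ) 0 = mat z 0 ^ n := by
    intro n
    induction n with
    | zero => simp [mat_one]
    | succ n ih => rw [pow_succ, pow_succ, ← ih, mat_mul]; simp
  have hcl : IsClosed {w : Circle | mat w 0 ∈ C} := hC.preimage hc
  have : closure (Set.range (z ^ · : ℕ → Circle)) ⊆ {w : Circle | mat w 0 ∈ C} := by
    refine closure_minimal ?_ hcl
    rintro _ ⟨n, rfl⟩
    change mat ((z ^ n : Circle) : ℂ) 0 ∈ C
    rw [hp]
    exact pow_mem h n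
  exact this (denseRange_pow hz w)

section Torus

variable (hT : ∀ w : Circle, mat w 0 ∈ C)

include hT

omit hT in
theorem exists_phase {a b : ℂ} (h : normSq a = normSq b) : ∃ w : Circle, b = w * a := by
  by_cases ha : a = 0
  · refine ⟨1, ?_⟩
    rw [ha, map_zero] at h
    rw [ha, mul_zero, normSq_eq_zero.1 h.symm]
  · have hn : ‖a‖ = ‖b‖ := by rw [Complex.norm_def, Complex.norm_def, h]
    refine ⟨⟨b / a, ?_⟩, ?_⟩
    · refine mem_sphere_zero_iff_norm.2 ?_
      rw [norm_div, hn, div_self]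
      rw [← hn]
      exact norm_ne_zero_iff.2 ha
    · exact (div_mul_cancel₀ b ha).symm

/-- Multiplication by the torus on both sides changes the phases of the two entries independently,
so membership depends only on the absolute values. -/
theorem mat_mem_of_normSq_eq {a b a' b' : ℂ} (h : mat a b ∈ C) (ha : normSq a = normSq a')
    (hb : normSq b = normSq b') : mat a' b' ∈ C := by
  obtain ⟨α, rfl⟩ := exists_phase ha
  obtain ⟨β, rfl⟩ := exists_phase hb
  -- The factors `u` on the left and `αu⁻¹` on the right multiply `a` by `α` and `b` by `u²α⁻¹ = β`.
  obtain ⟨u, hu⟩ : ∃ u : Circle, u * u = α * β := by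
    refine ⟨Circle.exp (arg (α * β : Circle) / 2), ?_⟩
    rw [← Circle.exp_add, add_halves, Circle.exp_arg]
  have e : mat u 0 * mat a b * mat (α * u⁻¹ : Circle) 0 = mat (α * a) (β * b) := by
    have h1 : (u : ℂ) * u = α * β := by exact_mod_cast congrArg Subtype.val hu
    have h2 : star ((α * u⁻¹ : Circle) : ℂ) = (α⁻¹ * u : Circle) := by
      rw [star_def, ← Circle.coe_inv_eq_conj]
      simp [mul_comm]
    rw [mat_mul, mat_mul, h2]
    congr 1
    · simp
      field_simp
    · simp
      field_simp
      linear_combination b * h1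
  rw [← e]
  exact mul_mem (mul_mem (hT _) h) (hT _)

/-- All matrices whose first entry has squared norm `X` are in `C`. -/
def Full (C : Submonoid (Matrix (Fin 2) (Fin 2) ℂ)) (X : ℝ) : Prop :=
  ∀ a b : ℂ, normSq a = X → normSq b = 1 - X → mat a b ∈ C

theorem full_of_mem {a b : ℂ} (h : mat a b ∈ C) (hab : normSq a + normSq b = 1) :
    Full C (normSq a) := fun a' b' ha hb =>
  mat_mem_of_normSq_eq hT h ha.symm (by rw [hb]; linarith)

omit hT in
theorem exists_circle_re {c : ℝ} (h : c ^ 2 ≤ 1) : ∃ w : Circle, (w : ℂ).re = c :=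
  ⟨Circle.exp (Real.arccos c), by
    have := abs_le.1 ((sq_le_one_iff_abs_le_one c).1 h)
    rw [Circle.coe_exp, exp_ofReal_mul_I_re, Real.cos_arccos this.1 this.2]⟩

/-- Two matrices with `|a|² = X` and relative phase `w` can be multiplied so that the first entry is
`Xw - (1 - X)`. As `w` runs through the circle, its squared norm fills the interval from `(2X - 1)²`
to `1`. -/
theorem full_step {X Y : ℝ} (hX : Full C X) (h0 : 0 < X) (h1 : X < 1) (hY : (2 * X - 1) ^ 2 ≤ Y)
    (hY1 : Y ≤ 1) : Full C Y := by
  have hp : 0 < X * (1 - X) := mul_pos h0 (by linarith)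
  -- The real part of `w` for which `|Xw - (1 - X)|² = Y`.
  set c : ℝ := (X ^ 2 + (1 - X) ^ 2 - Y) / (2 * (X * (1 - X))) with hc
  have hc' : 2 * (X * (1 - X)) * c = X ^ 2 + (1 - X) ^ 2 - Y := by
    rw [mul_comm]
    exact ((div_eq_iff (by linarith)).1 hc.symm).symm
  have hc1 : c ≤ 1 := by
    rw [hc, div_le_one (by linarith)]
    nlinarith
  have hc2 : -1 ≤ c := by
    rw [hc, le_div_iff₀ (by linarith)]
    nlinarith
  obtain ⟨w, hw⟩ := exists_circle_re (c := c) (by nlinarith)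
  have hwn : (w : ℂ).re * (w : ℂ).re + (w : ℂ).im * (w : ℂ).im = 1 := by
    have := Circle.normSq_coe w
    rwa [normSq_apply] at this
  have m1 : mat (Real.sqrt X) (Real.sqrt (1 - X)) ∈ C :=
    hX _ _ (by rw [normSq_ofReal, Real.mul_self_sqrt h0.le])
      (by rw [normSq_ofReal, Real.mul_self_sqrt (by linarith)])
  have m2 : mat (Real.sqrt X * w) (Real.sqrt (1 - X)) ∈ C :=
    hX _ _ (by rw [normSq_mul, normSq_ofReal, Real.mul_self_sqrt h0.le, Circle.normSq_coe, mul_one])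
      (by rw [normSq_ofReal, Real.mul_self_sqrt (by linarith)])
  have m := mul_mem m1 m2
  rw [mat_mul] at m
  have e1 : (Real.sqrt X : ℂ) * Real.sqrt X = X := by
    rw [← ofReal_mul, Real.mul_self_sqrt h0.le]
  have e2 : (Real.sqrt (1 - X) : ℂ) * Real.sqrt (1 - X) = (1 - X : ℝ) := by
    rw [← ofReal_mul, Real.mul_self_sqrt (by linarith)]
  have f1 : (Real.sqrt X : ℂ) * (Real.sqrt X * w) -
      Real.sqrt (1 - X) * star (Real.sqrt (1 - X) : ℂ) = X * w - (1 - X : ℝ) := by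
    rw [star_def, conj_ofReal, e2, ← mul_assoc, e1]
  have f2 : (Real.sqrt X : ℂ) * Real.sqrt (1 - X) +
      Real.sqrt (1 - X) * star (Real.sqrt X * w : ℂ) =
        (Real.sqrt X * Real.sqrt (1 - X) : ℝ) * (1 + star (w : ℂ)) := by
    rw [star_mul', star_def, conj_ofReal]
    push_cast
    ring
  rw [f1, f2] at m
  have n1 : normSq (X * w - (1 - X : ℝ)) = Y := by
    rw [normSq_apply]
    simp only [sub_re, sub_im, re_ofReal_mul, im_ofReal_mul, ofReal_re, ofReal_im]
    rw [hw] at hwn ⊢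
    linear_combination X ^ 2 * hwn - hc'
  have n2 : normSq ((Real.sqrt X * Real.sqrt (1 - X) : ℝ) * (1 + star (w : ℂ))) = 1 - Y := by
    rw [normSq_mul, normSq_ofReal, normSq_apply]
    simp only [add_re, add_im, star_def, conj_re, conj_im, one_re, one_im]
    have : Real.sqrt X * Real.sqrt (1 - X) * (Real.sqrt X * Real.sqrt (1 - X)) = X * (1 - X) := by
      rw [mul_mul_mul_comm, Real.mul_self_sqrt h0.le, Real.mul_self_sqrt (by linarith)]
    rw [this]
    rw [hw] at hwn ⊢
    linear_combination X * (1 - X) * hwn + hc'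
  rw [← n1]
  exact full_of_mem hT m (by rw [n1, n2]; ring)

/-- From `X = 1/2` one step reaches every value. If `1/2` were never reached, iterating `Z ↦ (2Z -
1)²` would stay above `1/2`, while `1 - (2Z - 1)² = 4Z(1 - Z) ≥ 2(1 - Z)` doubles the distance to
`1` each time. -/
theorem full_all {X : ℝ} (hX : Full C X) (h0 : 0 < X) (h1 : X < 1) {Y : ℝ} (hY0 : 0 ≤ Y)
    (hY1 : Y ≤ 1) : Full C Y := by
  suffices h : Full C (1 / 2) from full_step hT h (by norm_num) (by norm_num) (by linarith) hY1
  by_contra hn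
  have key : ∀ Z, Full C Z → 0 < Z → Z < 1 →
      Full C ((2 * Z - 1) ^ 2) ∧ 1 / 2 < (2 * Z - 1) ^ 2 ∧ (2 * Z - 1) ^ 2 < 1 := by
    intro Z hZ z0 z1
    have hlt : 1 / 2 < (2 * Z - 1) ^ 2 := by
      by_contra h
      exact hn (full_step hT hZ z0 z1 (not_lt.1 h) (by norm_num))
    have hlt1 : (2 * Z - 1) ^ 2 < 1 := by nlinarith
    exact ⟨full_step hT hZ z0 z1 le_rfl hlt1.le, hlt, hlt1⟩
  obtain ⟨k1, k2, k3⟩ := key X hX h0 h1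
  set Z := (2 * X - 1) ^ 2
  have iter : ∀ n : ℕ, ∃ W, Full C W ∧ 1 / 2 < W ∧ W < 1 ∧ 2 ^ n * (1 - Z) ≤ 1 - W := by
    intro n
    induction n with
    | zero => exact ⟨Z, k1, k2, k3, by simp⟩
    | succ n ih =>
      obtain ⟨W, w1, w2, w3, w4⟩ := ih
      obtain ⟨l1, l2, l3⟩ := key W w1 (by linarith) w3
      refine ⟨_, l1, l2, l3, ?_⟩
      rw [pow_succ]
      nlinarith
  obtain ⟨n, hn⟩ := pow_unbounded_of_one_lt (1 / (1 - Z)) (one_lt_two : (1 : ℝ) < 2)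
  obtain ⟨W, -, w2, -, w4⟩ := iter n
  rw [div_lt_iff₀ (by linarith)] at hn
  linarith

end Torus

/-- A closed monoid of matrices contains `SU(2)` if it contains a diagonal matrix of infinite order
and a matrix without zero entries. -/
theorem specialUnitary_subset_of_diagonal (hC : IsClosed (C : Set (Matrix (Fin 2) (Fin 2) ℂ)))
    {z : Circle} (hz : ∀ n : ℕ, 0 < n → z ^ n ≠ 1) (h : mat z 0 ∈ C) {a b : ℂ} (hab : mat a b ∈ C)
    (ha : a ≠ 0) (hb : b ≠ 0) (hn : normSq a + normSq b = 1) {M : Matrix (Fin 2) (Fin 2) ℂ}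
    (hM : M ∈ specialUnitaryGroup (Fin 2) ℂ) : M ∈ C := by
  have hT := mat_torus_mem hC hz h
  have pa := normSq_pos.2 ha
  have pb := normSq_pos.2 hb
  obtain ⟨e, he⟩ := eq_mat hM
  rw [e]
  exact full_all hT (full_of_mem hT hab hn) pa (by linarith) (normSq_nonneg _)
    (by linarith [normSq_nonneg (M 0 1)]) _ _ rfl (by linarith)

/-- If `z + z⁻¹` is the square of the inverse of the golden ratio, then `z` is not a root of unity,
since the conjugate of this number is greater than `2`. -/
theorem pow_ne_one {z : ℂ} (h : z + z⁻¹ = 2 - Real.goldenRatio) {n : ℕ} (hn : 0 < n) :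
    z ^ n ≠ 1 := by
  have hz : z ≠ 0 := by
    rintro rfl
    rw [_root_.inv_zero, add_zero] at h
    have h0 : (0 : ℝ) = 2 - Real.goldenRatio := by exact_mod_cast h
    linarith [Real.goldenRatio_lt_two]
  set r : ℝ := Real.sqrt 5 with hr
  have h5 : r ^ 2 = 5 := Real.sq_sqrt (by norm_num)
  have h5' : (r : ℂ) ^ 2 = 5 := by exact_mod_cast congrArg ofReal h5
  have hr1 : 1 < r := Real.lt_sqrt_of_sq_lt (by norm_num)
  have h' : z + z⁻¹ = 3 / 2 - r / 2 := by
    rw [h, Real.goldenRatio]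
    push_cast
    ring
  -- The numbers `z^m + z^{-m}` lie in `ℚ(√5)` and satisfy `t_{m+2} = t_1 t_{m+1} - t_m`. Their
  -- conjugates satisfy the conjugate recursion with coefficient `(3 + √5)/2 > 2`, start at `2` and
  -- strictly increase.
  have key : ∀ m : ℕ, ∃ x y x' y' : ℚ, z ^ m + z⁻¹ ^ m = x + y * r ∧
      z ^ (m + 1) + z⁻¹ ^ (m + 1) = x' + y' * r ∧ (2 : ℝ) ≤ x - y * r ∧
      (x - y * r : ℝ) < x' - y' * r := by
    intro m
    induction m with
    | zero =>
      refine ⟨2, 0, 3 / 2, -1 / 2, by norm_num, ?_, by simp, ?_⟩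
      · push_cast
        linear_combination h'
      · push_cast
        linarith
    | succ m ih =>
      obtain ⟨x, y, x', y', e1, e2, i1, i2⟩ := ih
      refine ⟨x', y', 3 / 2 * x' - 5 / 2 * y' - x, 3 / 2 * y' - 1 / 2 * x' - y, e2, ?_,
        by linarith, ?_⟩
      · have e3 : z ^ (m + 1 + 1) + z⁻¹ ^ (m + 1 + 1) =
            (z + z⁻¹) * (z ^ (m + 1) + z⁻¹ ^ (m + 1)) - (z ^ m + z⁻¹ ^ m) := by
          have e : ∀ w, z * w = 1 → z ^ (m + 1 + 1) + w ^ (m + 1 + 1) =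
              (z + w) * (z ^ (m + 1) + w ^ (m + 1)) - (z ^ m + w ^ m) := fun w hw => by
            linear_combination -(z ^ m + w ^ m) * hw
          exact e _ (mul_inv_cancel₀ hz)
        rw [e3, e1, e2, h']
        push_cast
        linear_combination (-(y' : ℂ) / 2) * h5'
      · push_cast
        have : (0 : ℝ) < (r - 1) / 2 * (x' - y' * r) := mul_pos (by linarith) (by linarith)
        linear_combination i2 + this - (y' : ℝ) / 2 * h5
  intro h1
  obtain ⟨m, rfl⟩ : ∃ m, n = m + 1 := ⟨n - 1, by omega⟩
  obtain ⟨x, y, x', y', -, e, i1, i2⟩ := key m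
  rw [inv_pow, h1, inv_one] at e
  have e' : (1 + 1 : ℝ) = x' + y' * r := by exact_mod_cast e
  -- If `z^n = 1`, then `x' + y'√5 = 2`. As `√5` is irrational, `y' = 0` and `x' = 2`, but the
  -- conjugate must exceed `2`.
  by_cases hy : y' = 0
  · rw [hy] at e' i2
    push_cast at e' i2
    linarith
  · have hirr : Irrational r := by
      simpa using Nat.Prime.irrational_sqrt (p := 5) (by norm_num)
    refine hirr ⟨(2 - x') / y', ?_⟩
    have hy' : (y' : ℝ) ≠ 0 := by exact_mod_cast hy
    push_cast
    rw [div_eq_iff hy']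
    linarith

/-- A closed monoid of matrices contains `SU(2)` if it contains two non-commuting elements of `SU(2)`
whose trace is `2 - φ`. -/
theorem specialUnitary_subset (hC : IsClosed (C : Set (Matrix (Fin 2) (Fin 2) ℂ)))
    {g h : Matrix (Fin 2) (Fin 2) ℂ} (hg : g ∈ C) (hh : h ∈ C)
    (hgS : g ∈ specialUnitaryGroup (Fin 2) ℂ) (hhS : h ∈ specialUnitaryGroup (Fin 2) ℂ)
    (tg : g.trace = 2 - Real.goldenRatio) (th : h.trace = 2 - Real.goldenRatio)
    (hgh : g * h ≠ h * g) {M : Matrix (Fin 2) (Fin 2) ℂ}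
    (hM : M ∈ specialUnitaryGroup (Fin 2) ℂ) : M ∈ C := by
  -- In `SU(2)` the sum `g + g*` is a scalar matrix, so a unitary that diagonalises this Hermitian
  -- matrix also diagonalises `g`.
  have hherm : (I • (g - star g)).IsHermitian := by
    change star (I • (g - star g)) = _
    rw [star_smul, star_sub, star_star, star_def, conj_I, neg_smul, ← smul_neg, neg_sub]
  set U : unitaryGroup (Fin 2) ℂ := hherm.eigenvectorUnitary
  have hU1 : star U.1 * U.1 = 1 := Unitary.star_mul_self_of_mem U.2
  have hU2 : U.1 * star U.1 = 1 := Unitary.mul_star_self_of_mem U.2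
  let conj : Matrix (Fin 2) (Fin 2) ℂ →* Matrix (Fin 2) (Fin 2) ℂ :=
    { toFun := fun X => U.1 * X * star U.1
      map_one' := by rw [mul_one, hU2]
      map_mul' := fun X Y => by
        calc U.1 * (X * Y) * star U.1 = U.1 * X * 1 * Y * star U.1 := by
              simp only [mul_one, Matrix.mul_assoc]
          _ = _ := by rw [← hU1]; simp only [Matrix.mul_assoc] }
  have hconj : ∀ X, conj (star U.1 * X * U.1) = X := fun X => by
    calc U.1 * (star U.1 * X * U.1) * star U.1 = (U.1 * star U.1) * X * (U.1 * star U.1) := by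
          simp only [Matrix.mul_assoc]
      _ = X := by rw [hU2, one_mul, mul_one]
  have hSU : ∀ X ∈ specialUnitaryGroup (Fin 2) ℂ,
      star U.1 * X * U.1 ∈ specialUnitaryGroup (Fin 2) ℂ := by
    intro X hX
    obtain ⟨h1, h2⟩ := mem_specialUnitaryGroup_iff.1 hX
    refine mem_specialUnitaryGroup_iff.2
      ⟨mul_mem (mul_mem (Unitary.star_mem U.2) h1) U.2, ?_⟩
    rw [det_mul, det_mul, h2, mul_one, ← det_mul, hU1, det_one]
  have htr : ∀ X, (star U.1 * X * U.1).trace = X.trace := fun X => by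
    rw [trace_mul_comm, ← Matrix.mul_assoc, hU2, one_mul]
  set C' : Submonoid (Matrix (Fin 2) (Fin 2) ℂ) := C.comap conj
  have hC' : IsClosed (C' : Set (Matrix (Fin 2) (Fin 2) ℂ)) :=
    hC.preimage (show Continuous fun X => U.1 * X * star U.1 by fun_prop)
  have mem' : ∀ X ∈ C, star U.1 * X * U.1 ∈ C' := fun X hX => by
    rw [Submonoid.mem_comap, hconj]
    exact hX
  obtain ⟨eg, ng⟩ := eq_mat (hSU g hgS)
  obtain ⟨eh, nh⟩ := eq_mat (hSU h hhS)
  have hdiag : (star U.1 * g * U.1) 0 1 = 0 := by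
    have e1 : star U.1 * (I • (g - star g)) * U.1 = diagonal (RCLike.ofReal ∘ hherm.eigenvalues) := by
      rw [← hherm.conjStarAlgAut_star_eigenvectorUnitary, Unitary.conjStarAlgAut_star_apply]
    have e2 : star U.1 * (I • (g - star g)) * U.1 =
        I • (star U.1 * g * U.1 - star (star U.1 * g * U.1)) := by
      rw [star_mul, star_mul, star_star, Matrix.mul_smul, Matrix.smul_mul, Matrix.mul_sub,
        Matrix.sub_mul, Matrix.mul_assoc _ (star g)]
    have e3 := congrFun (congrFun (e2.symm.trans e1) 0) 1
    rw [eg] at e3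
    simpa [mat, I_ne_zero, ← two_mul] using e3
  set a := (star U.1 * g * U.1) 0 0
  set c := (star U.1 * h * U.1) 0 0
  set d := (star U.1 * h * U.1) 0 1
  rw [hdiag] at eg ng
  have ta : a + star a = 2 - Real.goldenRatio := by
    rw [← tg, ← htr g, eg]
    simp [mat, trace_fin_two]
  have tc : c + star c = 2 - Real.goldenRatio := by
    rw [← th, ← htr h, eh]
    simp [mat, trace_fin_two]
  have hna : normSq a = 1 := by simpa using ng
  let z : Circle := ⟨a, mem_sphere_zero_iff_norm.2 (by rw [Complex.norm_def, hna, Real.sqrt_one])⟩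
  have hz : ∀ n : ℕ, 0 < n → z ^ n ≠ 1 := by
    intro n hn hz
    have hs : star a = a⁻¹ := by
      rw [Complex.inv_def, hna]
      simp
    rw [hs] at ta
    refine pow_ne_one ta hn ?_
    exact congrArg Subtype.val hz
  -- The trace of `h` is nonzero, so its diagonal does not vanish; if `d` vanished, `h` would be
  -- diagonal along with `g` and commute with it.
  have hc0 : c ≠ 0 := by
    intro h0
    rw [h0, star_zero, add_zero] at tc
    have h0 : (0 : ℝ) = 2 - Real.goldenRatio := by exact_mod_cast tc
    linarith [Real.goldenRatio_lt_two]
  have hd0 : d ≠ 0 := by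
    intro h0
    apply hgh
    rw [← hconj g, ← hconj h, ← map_mul, ← map_mul, eg, eh, h0, mat_mul, mat_mul]
    simp [mul_comm]
  have hM' := specialUnitary_subset_of_diagonal hC' hz (z := z) (by
    change mat a 0 ∈ C'
    rw [← eg]
    exact mem' g hg) (eh ▸ mem' h hh) hc0 hd0 nh (hSU M hM)
  rw [Submonoid.mem_comap, hconj] at hM'
  exact hM'

end SU2

end

noncomputable section

namespace Fib

open Matrix

/-! ### Two non-commuting braids of infinite order; conclusion -/

section MatrixRep

variable {n : ℕ} {i : Charge} (b : Module.Basis (Fin n) ℂ (V i))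

theorem matrixRep_apply (β : BraidGroup 3) :
    matrixRep i b β = LinearMap.toMatrix b b (rho i β) := rfl

theorem matrixRep_mul_inv (β : BraidGroup 3) : matrixRep i b β * matrixRep i b β⁻¹ = 1 := by
  rw [← map_mul, mul_inv_cancel, map_one]

theorem trace_matrixRep {m : ℕ} (c : Module.Basis (Fin m) ℂ (V i)) (β : BraidGroup 3) :
    (matrixRep i b β).trace = (matrixRep i c β).trace := by
  rw [matrixRep_apply, matrixRep_apply, ← LinearMap.trace_eq_matrix_trace,
    ← LinearMap.trace_eq_matrix_trace]

theorem det_matrixRep {m : ℕ} (c : Module.Basis (Fin m) ℂ (V i)) (β : BraidGroup 3) :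
    (matrixRep i b β).det = (matrixRep i c β).det := by
  rw [matrixRep_apply, matrixRep_apply, LinearMap.det_toMatrix, LinearMap.det_toMatrix]

theorem matrixRep_eq_iff {m : ℕ} (c : Module.Basis (Fin m) ℂ (V i)) (β γ : BraidGroup 3) :
    matrixRep i b β = matrixRep i b γ ↔ matrixRep i c β = matrixRep i c γ := by
  simp only [matrixRep_apply, EmbeddingLike.apply_eq_iff_eq]

theorem matrixRep_mem_unitaryGroup
    (hb : ∀ j k, traceInner i (b j) (b k) = if j = k then 1 else 0) (β : BraidGroup 3) :
    matrixRep i b β ∈ unitaryGroup (Fin n) ℂ :=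
  (inner_map_eq_iff hb _).1 (traceInner_rho i β)

end MatrixRep

theorem eq_of_entries {a b c d a' b' c' d' : ℂ} (ha : a = a') (hb : b = b') (hc : c = c')
    (hd : d = d') : !![a, b; c, d] = !![a', b'; c', d'] := by
  rw [ha, hb, hc, hd]

/-- This basis is not orthonormal, but the generators are triangular in it. Trace, determinant and
commutation do not depend on the basis; unitarity is taken from an orthonormal one. -/
theorem exists_basis_diagrams (b : Module.Basis (Fin 2) ℂ (V .tau)) :
    ∃ e : Module.Basis (Fin 2) ℂ (V .tau), e 0 = v₁ ∧ e 1 = v₂ := by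
  let e := basisOfTopLeSpanOfCardEqFinrank ![v₁, v₂] span_v₁_v₂
    (Module.finrank_eq_card_basis b).symm
  have h : ⇑e = ![v₁, v₂] := coe_basisOfTopLeSpanOfCardEqFinrank _ _ _
  exact ⟨e, by rw [h]; rfl, by rw [h]; rfl⟩

section Generators

variable {e : Module.Basis (Fin 2) ℂ (V .tau)} (h0 : e 0 = v₁) (h1 : e 1 = v₂)

include h0 h1

theorem matrixRep_zero :
    matrixRep .tau e (braidGen 0) = !![kauffmanA ^ 2, -kauffmanA ^ 4; 0, kauffmanA] := by
  have e0 : rho .tau (braidGen 0) (e 0) = kauffmanA ^ 2 • e 0 := by rw [h0, rho_zero_v₁]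
  have e1 : rho .tau (braidGen 0) (e 1) = kauffmanA • e 1 - kauffmanA ^ 4 • e 0 := by
    rw [h0, h1, rho_zero_v₂]
  ext i j
  rw [matrixRep_apply, LinearMap.toMatrix_apply]
  fin_cases i <;> fin_cases j <;> simp [e0, e1]

theorem matrixRep_one :
    matrixRep .tau e (braidGen 1) = !![kauffmanA, 0; -kauffmanA ^ 4, kauffmanA ^ 2] := by
  have e0 : rho .tau (braidGen 1) (e 0) = kauffmanA • e 0 - kauffmanA ^ 4 • e 1 := by
    rw [h0, h1, rho_one_v₁]
  have e1 : rho .tau (braidGen 1) (e 1) = kauffmanA ^ 2 • e 1 := by rw [h1, rho_one_v₂]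
  ext i j
  rw [matrixRep_apply, LinearMap.toMatrix_apply]
  fin_cases i <;> fin_cases j <;> simp [e0, e1]

theorem matrixRep_one_inv : matrixRep .tau e (braidGen 1)⁻¹ =
    !![-kauffmanA ^ 4, 0; kauffmanA, -kauffmanA ^ 3] := by
  have h := matrixRep_mul_inv e (braidGen 1)
  refine (left_inv_eq_right_inv ?_ h).symm
  have hA := kauffmanA_pow_five
  rw [matrixRep_one h0 h1]
  rw [mul_fin_two, one_fin_two]
  refine eq_of_entries ?_ ?_ ?_ ?_
  · linear_combination -hA
  · ring
  · linear_combination kauffmanA ^ 2 * hA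
  · linear_combination -hA

/-- Both generators have determinant `A³`, so this quotient has determinant one, as needed for
`SU(2)`. -/
theorem matrixRep_zero_mul_one_inv : matrixRep .tau e (braidGen 0 * (braidGen 1)⁻¹) =
    !![kauffmanA + 1, -kauffmanA ^ 2; kauffmanA ^ 2, -kauffmanA ^ 4] := by
  have hA := kauffmanA_pow_five
  rw [map_mul, matrixRep_zero h0 h1, matrixRep_one_inv h0 h1]
  rw [mul_fin_two]
  refine eq_of_entries ?_ ?_ ?_ ?_
  · linear_combination -(kauffmanA + 1) * hA
  · linear_combination kauffmanA ^ 2 * hA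
  · ring
  · ring

theorem matrixRep_one_inv_mul_zero : matrixRep .tau e ((braidGen 1)⁻¹ * braidGen 0) =
    !![kauffmanA, -kauffmanA ^ 3; kauffmanA ^ 3, 1 - kauffmanA ^ 4] := by
  have hA := kauffmanA_pow_five
  rw [map_mul, matrixRep_zero h0 h1, matrixRep_one_inv h0 h1]
  rw [mul_fin_two]
  refine eq_of_entries ?_ ?_ ?_ ?_
  · linear_combination -kauffmanA * hA
  · linear_combination kauffmanA ^ 3 * hA
  · ring
  · linear_combination -hA

end Generators

theorem specialUnitaryGroup_subset_closure_tau {b : Module.Basis (Fin 2) ℂ (V .tau)}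
    (hb : ∀ j k, traceInner .tau (b j) (b k) = if j = k then 1 else 0)
    {M : Matrix (Fin 2) (Fin 2) ℂ} (hM : M ∈ specialUnitaryGroup (Fin 2) ℂ) :
    M ∈ closure (Set.range (matrixRep .tau b)) := by
  obtain ⟨e, h0, h1⟩ := exists_basis_diagrams b
  have hA := kauffmanA_pow_four
  have h5 := kauffmanA_pow_five
  have hd : (2 : ℂ) - Real.goldenRatio = 2 - (kauffmanA ^ 3 - kauffmanA ^ 2) := by
    rw [← loopValue_eq, loopValue_eq_kauffmanA]
  have g1 := matrixRep_zero_mul_one_inv h0 h1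
  have g2 := matrixRep_one_inv_mul_zero h0 h1
  generalize braidGen 0 * (braidGen 1)⁻¹ = x at g1
  generalize (braidGen 1)⁻¹ * braidGen 0 = y at g2
  let C := (MonoidHom.mrange (matrixRep .tau b)).topologicalClosure
  have mem : ∀ β, matrixRep .tau b β ∈ C := fun β =>
    Submonoid.le_topologicalClosure _ ⟨β, rfl⟩
  have hSU : ∀ β, (matrixRep .tau e β).det = 1 →
      matrixRep .tau b β ∈ specialUnitaryGroup (Fin 2) ℂ := fun β h =>
    mem_specialUnitaryGroup_iff.2 ⟨matrixRep_mem_unitaryGroup b hb β, by rw [det_matrixRep b e, h]⟩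
  have hx : (matrixRep .tau e x).det = 1 := by
    rw [g1, det_fin_two_of]
    linear_combination -h5
  have hy : (matrixRep .tau e y).det = 1 := by
    rw [g2, det_fin_two_of]
    linear_combination (kauffmanA - 1) * h5
  have tx : (matrixRep .tau b x).trace = 2 - Real.goldenRatio := by
    rw [trace_matrixRep b e, g1, trace_fin_two_of, hd]
    linear_combination -hA
  have ty : (matrixRep .tau b y).trace = 2 - Real.goldenRatio := by
    rw [trace_matrixRep b e, g2, trace_fin_two_of, hd]
    linear_combination -hA
  -- Comparing the upper right entries, commutation would force `A³ = -1`. Together with `A⁵ = -1`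
  -- this gives `A = -1`, which violates the cyclotomic equation.
  have hne : matrixRep .tau b x * matrixRep .tau b y ≠ matrixRep .tau b y * matrixRep .tau b x := by
    rw [← map_mul, ← map_mul, Ne, matrixRep_eq_iff b e, map_mul, map_mul, g1, g2]
    intro h
    have h' := congrFun (congrFun h 0) 1
    simp only [Matrix.mul_apply, Fin.sum_univ_two, of_apply, cons_val', cons_val_zero,
      cons_val_one, cons_val_fin_one] at h'
    have h4 : kauffmanA * (kauffmanA ^ 3 + 1) = 0 := by
      linear_combination -h' + (kauffmanA - kauffmanA ^ 2) * h5
    have h3 := (mul_eq_zero.1 h4).resolve_left kauffmanA_ne_zero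
    have h2 : kauffmanA ^ 2 = 1 := by linear_combination kauffmanA ^ 2 * h3 - h5
    have h1 : kauffmanA = -1 := by linear_combination h3 - kauffmanA * h2
    rw [h1] at hA
    norm_num at hA
  exact SU2.specialUnitary_subset (C := C) (Submonoid.isClosed_topologicalClosure _) (mem x) (mem y)
    (hSU x hx) (hSU y hy) tx ty hne hM

theorem specialUnitaryGroup_subset_closure_one (b : Module.Basis (Fin 1) ℂ (V .one))
    {M : Matrix (Fin 1) (Fin 1) ℂ} (hM : M ∈ specialUnitaryGroup (Fin 1) ℂ) :
    M ∈ closure (Set.range (matrixRep .one b)) := by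
  have h : M = 1 := by
    ext i j
    rw [Subsingleton.elim i 0, Subsingleton.elim j 0, ← det_fin_one M,
      (mem_specialUnitaryGroup_iff.1 hM).2]
    rfl
  exact subset_closure ⟨1, by rw [map_one, h]⟩

theorem exists_orthonormal_dense (i : Charge) : ∃ b : Module.Basis (Fin i.dim) ℂ (V i),
    (∀ j k, traceInner i (b j) (b k) = if j = k then 1 else 0) ∧
      ∀ M ∈ specialUnitaryGroup (Fin i.dim) ℂ, M ∈ closure (Set.range (matrixRep i b)) := by
  cases i
  · obtain ⟨b, hb⟩ := exists_orthonormal_one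
    exact ⟨b, hb, fun M hM => specialUnitaryGroup_subset_closure_one b hM⟩
  · obtain ⟨b, hb⟩ := exists_orthonormal_tau
    exact ⟨b, hb, fun M hM => specialUnitaryGroup_subset_closure_tau hb hM⟩

end Fib

end

theorem theorem4 (i : Fib.Charge) :
    ∃ ip : Fib.V i →ₗ⋆[ℂ] Fib.V i →ₗ[ℂ] ℂ,
      Fib.IsTraceInnerProduct i ip ∧
      (∀ (β : Fib.BraidGroup 3) (v w : Fib.V i), ip (Fib.rho i β v) (Fib.rho i β w) = ip v w) ∧
      (∃ b : Module.Basis (Fin i.dim) ℂ (Fib.V i), ∀ g : Module.End ℂ (Fib.V i),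
        g ∈ Fib.specialUnitary ip ↔
          LinearMap.toMatrix b b g ∈ Matrix.specialUnitaryGroup (Fin i.dim) ℂ) ∧
      Fib.specialUnitary ip ⊆ closure (Set.range (Fib.rho i)) := by
  obtain ⟨b, hb, hd⟩ := Fib.exists_orthonormal_dense i
  exact ⟨Fib.traceInner i,
    ⟨Fib.traceInner_trace_form i, Fib.inner_hermitian hb, fun _ => Fib.inner_pos hb⟩,
    Fib.traceInner_rho i, ⟨b, Fib.mem_specialUnitary_iff hb⟩,
    Fib.specialUnitary_subset_closure hb hd⟩
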